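/- Let $p,d\ge 0$ and $q_1,\dots,q_p\ge 0$ be integers, let $I=\{(i,j):1\le i\le p,\ 1\le j\le q_i\}$, and let $(\vec v_{ij})_{(i,j)\in I}$ be vectors in $\mathbb{Z}^d$ which span $\mathbb{Z}^d$ over $\mathbb{Z}$. Let $$K_0=\Big\{\vec k\in\mathbb{Z}^I:\ \sum_{(i,j)\in I}k_{ij}\vec v_{ij}=0 \text{ and } k_{ij}\ge 0 \text{ for all } (i,j)\in I\Big\}$$ be the monoid of non-negative integer relations among the $\vec v_{ij}$. For $R=\mathbb{Z}$ or $\mathbb{Q}$, let $R[[K_0]]$ be the completed monoid ring, i.e. the ring of formal power series over $R$ in variables $z_{ij}$, $(i,j)\in I$, in which only monomials $\vec z^{\vec k}$ with $\vec k\in K_0$ occur. Put $H(n)=\sum_{m=1}^n \frac1m$ and, for $\vec k \in K_0$, $$c(\vec k)=\prod_{i=1}^p\frac{\big(\sum_{j=1}^{q_i}k_{ij}\big)!}{\prod_{j=1}^{q_i}k_{ij}!}.$$ Define $$\phi_0=\sum_{\vec k\in K_0}c(\vec k)\,\vec z^{\vec k},\qquad \phi_{ij}=\sum_{\vec k\in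 K_0}c(\vec k)\Big(H\Big(\sum_{l=1}^{q_i}k_{il}\Big)-H(k_{ij})\Big)\vec z^{\vec k},\qquad \psi^{\mathrm n}_{ij}=\exp(\phi_{ij}/\phi_0)\in\mathbb{Q}[[K_0]].$$ Let $\Delta=\Delta_1+\dots+\Delta_p\subset\mathbb{R}^d$ be the Minkowski sum of the polytopes $\Delta_i$, where $\Delta_i$ is the convex hull of the origin and the vectors $\vec v_{i1},\dots,\vec v_{iq_i}$. Suppose that the data $(\vec v_{ij})$ are Fano, i.e. the origin lies in the interior of $\Delta$ and is the only point of $\mathbb{Z}^d$ in the interior of $\Delta$, and suppose that there is an isomorphism of monoids $K_0\cong\mathbb{N}^r$ for some integer $r\ge 0$. Then for every $(i,j)\in I$ the series $\psi^{\mathrm n}_{ij}$ has integer coefficients, i.e. it lies in $\mathbb{Z}[[K_0]]$. -/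

import Mathlib

open scoped Pointwise

noncomputable section

namespace NaiveMirror

/-- The index set `I = {(i, j) : 1 ≤ i ≤ p, 1 ≤ j ≤ q_i}`. -/
abbrev Idx {p : ℕ} (q : Fin p → ℕ) : Type := (i : Fin p) × Fin (q i)

/-- The linear map `ℤ^I → ℤ^d` sending the basis vector `e_{ij}` to `v_{ij}`. -/
def V {d p : ℕ} {q : Fin p → ℕ} (v : Idx q → Fin d → ℤ) :
    (Idx q → ℤ) →ₗ[ℤ] (Fin d → ℤ) :=
  Fintype.linearCombination ℤ v

/-- The lattice `K ⊆ ℤ^I` of integer relations among the `v_{ij}`. -/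
def K {d p : ℕ} {q : Fin p → ℕ} (v : Idx q → Fin d → ℤ) : Submodule ℤ (Idx q → ℤ) :=
  LinearMap.ker (V v)

/-- The monoid `K₀` of relations with non-negative coefficients. -/
def K₀ {d p : ℕ} {q : Fin p → ℕ} (v : Idx q → Fin d → ℤ) : AddSubmonoid (Idx q → ℤ) where
  carrier := {k | k ∈ K v ∧ ∀ a, 0 ≤ k a}
  zero_mem' := ⟨(K v).zero_mem, fun _ => le_rfl⟩
  add_mem' := fun h h' => ⟨(K v).add_mem h.1 h'.1, fun a => add_nonneg (h.2 a) (h'.2 a)⟩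

/-- A monomial exponent, in `ℕ^I`, seen as an element of `ℤ^I`. -/
def expo {p : ℕ} {q : Fin p → ℕ} (m : Idx q →₀ ℕ) : Idx q → ℤ := fun a => (m a : ℤ)

theorem expo_zero {p : ℕ} {q : Fin p → ℕ} : expo (0 : Idx q →₀ ℕ) = 0 := by
  funext a; simp [expo]

theorem expo_add {p : ℕ} {q : Fin p → ℕ} (m n : Idx q →₀ ℕ) :
    expo (m + n) = expo m + expo n := by
  funext a; simp [expo]

/-- The completed monoid ring `R[[K₀]]`: as `K₀` lies in `ℕ^I`, it is the ring of formal power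
series in variables `z_{ij}` in which only monomials `z^k` with `k ∈ K₀` occur. -/
def CompletedRing (R : Type*) [CommRing R] {d p : ℕ} {q : Fin p → ℕ}
    (v : Idx q → Fin d → ℤ) : Subring (MvPowerSeries (Idx q) R) where
  carrier := {f | ∀ m, MvPowerSeries.coeff m f ≠ 0 → expo m ∈ K₀ v}
  zero_mem' := fun m h => absurd (map_zero _) h
  one_mem' := fun m h => by
    classical
    have hm : m = 0 := by
      by_contra hm
      exact h (by rw [MvPowerSeries.coeff_one, if_neg hm])
    rw [hm, expo_zero]
    exact (K₀ v).zero_mem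
  add_mem' := fun {f g} hf hg m h => by
    by_cases h1 : MvPowerSeries.coeff m f = 0
    · refine hg m fun h2 => h ?_
      rw [map_add, h1, h2, add_zero]
    · exact hf m h1
  neg_mem' := fun {f} hf m h => hf m fun h1 => h (by rw [map_neg, h1, neg_zero])
  mul_mem' := fun {f g} hf hg m h => by
    classical
    rw [MvPowerSeries.coeff_mul] at h
    obtain ⟨⟨a, b⟩, hab, hne⟩ := Finset.exists_ne_zero_of_sum_ne_zero h
    rw [← Finset.HasAntidiagonal.mem_antidiagonal.mp hab, expo_add]
    exact (K₀ v).add_mem (hf a (left_ne_zero_of_mul hne)) (hg b (right_ne_zero_of_mul hne))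

/-- `∏ᵢ comb(k_{i1}, …, k_{iqᵢ})`, a product of multinomial coefficients. -/
def combProd {p : ℕ} {q : Fin p → ℕ} (k : Idx q →₀ ℕ) : ℕ :=
  ∏ i, Nat.multinomial Finset.univ (fun j : Fin (q i) => k ⟨i, j⟩)

open Classical in
/-- The power series `φ₀`. -/
def φ₀ {d p : ℕ} {q : Fin p → ℕ} (v : Idx q → Fin d → ℤ) : MvPowerSeries (Idx q) ℚ :=
  fun k => if expo k ∈ K₀ v then (combProd k : ℚ) else 0

open Classical in
/-- The power series `φ_{ij}`; `harmonic n` is `1 + 1/2 + … + 1/n`. -/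
def φ {d p : ℕ} {q : Fin p → ℕ} (v : Idx q → Fin d → ℤ) (a : Idx q) :
    MvPowerSeries (Idx q) ℚ :=
  fun k => if expo k ∈ K₀ v then
    (combProd k : ℚ) * (harmonic (∑ j, k ⟨a.1, j⟩) - harmonic (k a)) else 0

open Classical in
theorem constantCoeff_φ₀ {d p : ℕ} {q : Fin p → ℕ} (v : Idx q → Fin d → ℤ) :
    MvPowerSeries.constantCoeff (φ₀ v) = 1 := by
  have h : expo (0 : Idx q →₀ ℕ) ∈ K₀ v := by rw [expo_zero]; exact (K₀ v).zero_mem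
  rw [← MvPowerSeries.coeff_zero_eq_constantCoeff_apply]
  change (if expo 0 ∈ K₀ v then (combProd 0 : ℚ) else 0) = 1
  rw [if_pos h]
  simp [combProd, Nat.multinomial]

open Classical in
theorem constantCoeff_φ {d p : ℕ} {q : Fin p → ℕ} (v : Idx q → Fin d → ℤ) (a : Idx q) :
    MvPowerSeries.constantCoeff (φ v a) = 0 := by
  rw [← MvPowerSeries.coeff_zero_eq_constantCoeff_apply]
  change (if expo 0 ∈ K₀ v then (combProd 0 : ℚ) *
    (harmonic (∑ j, (0 : Idx q →₀ ℕ) ⟨a.1, j⟩) - harmonic ((0 : Idx q →₀ ℕ) a)) else 0) = 0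
  simp

/-- The quotient `φ_{ij} / φ₀`; `φ₀` is invertible, its constant term being `1`. -/
def logψ {d p : ℕ} {q : Fin p → ℕ} (v : Idx q → Fin d → ℤ) (a : Idx q) :
    MvPowerSeries (Idx q) ℚ :=
  φ v a * (φ₀ v)⁻¹

/-- The quotient `φ_{ij} / φ₀` has no constant term, so it may be substituted in `exp`. -/
theorem hasSubst_logψ {d p : ℕ} {q : Fin p → ℕ} (v : Idx q → Fin d → ℤ) (a : Idx q) :
    PowerSeries.HasSubst (logψ v a) :=
  PowerSeries.HasSubst.of_constantCoeff_zero (by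
    rw [logψ, map_mul, constantCoeff_φ, zero_mul])

/-- The component `ψ_{ij} = exp(φ_{ij} / φ₀)` of the naive mirror map. -/
def ψ {d p : ℕ} {q : Fin p → ℕ} (v : Idx q → Fin d → ℤ) (a : Idx q) :
    MvPowerSeries (Idx q) ℚ :=
  (PowerSeries.exp ℚ).subst (logψ v a)

/-- The inclusion `ℤ^d ⊆ ℝ^d`. -/
def toReal {d : ℕ} (n : Fin d → ℤ) : Fin d → ℝ := fun l => (n l : ℝ)

/-- The polytope `Δᵢ`, the convex hull of the origin and the `v_{ij}`, `1 ≤ j ≤ q_i`. -/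
def Δpart {d p : ℕ} {q : Fin p → ℕ} (v : Idx q → Fin d → ℤ) (i : Fin p) : Set (Fin d → ℝ) :=
  convexHull ℝ (insert 0 (Set.range fun j : Fin (q i) => toReal (v ⟨i, j⟩)))

/-- The Minkowski sum `Δ = Δ₁ + ⋯ + Δ_p`. -/
def Δ {d p : ℕ} {q : Fin p → ℕ} (v : Idx q → Fin d → ℤ) : Set (Fin d → ℝ) :=
  ∑ i, Δpart v i

/-- The data are Fano if the origin is the unique lattice point in the interior of `Δ`
(in particular, it lies in the interior). -/
def IsFano {d p : ℕ} {q : Fin p → ℕ} (v : Idx q → Fin d → ℤ) : Prop :=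
  ∀ n : Fin d → ℤ, toReal n ∈ interior (Δ v) ↔ n = 0

end NaiveMirror

end

/-!
Write `f = ∏ᵢ (1 - ∑ⱼ z_{ij} x^{v_{ij}})` and `F = 1 / f`. The coefficients of `F` are the products
of multinomial coefficients `c(k)`, and the power of `x` accompanying `z^k` is `∑ k_{ij} v_{ij}`, so
`φ₀` is the constant term of `F` in `x`. Since the `x`-degree is determined by the exponent of `z`,
the variables `x` are dropped and replaced by the grading `degHom v`; taking constant terms becomes
`proj (degHom v) ⊥`. A computation with harmonic numbers (`harmonicSeries_eq`) shows that `φ_{ij}`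
is the constant term of `L F` with `L = -log (1 - ∑_{l ≠ j} z_{il} x^{v_{il}})`.

Integrality is checked at one prime `p` at a time. Let `σ` be the substitution of `p`-th powers for
all variables. By the lemma of Dieudonné and Dwork (`exp_subst_mem_pSeries`) it is enough that
`σ(φ_{ij} / φ₀) - p φ_{ij} / φ₀` is divisible by `p`. As `σ L - p L` is divisible by `p`
(`exists_expand_logSeries`), this amounts to comparing `F` with `λ σ(F)`, where `λ = φ₀ / σ(φ₀)`, in
the constant term of `σ(L) F`. The denominators of `L` are harmless if the coefficients of
`F - λ σ(F)` in degrees divisible by `p^s` are divisible by `p^s`; this is `dwork_congruence`.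

The congruence is proved by the method of Dwork crystals. The Newton polytope of `f` lies in `Δ`.
Because `f^p ≡ σ(f)` modulo `p`, keeping only the monomials of degree divisible by `p` turns a pole
of order `k + 1` along `f = 0` into poles along `σ(f) = 0` whose numerators again lie in the
interior of the corresponding multiple of `Δ`, and poles of order greater than one acquire
additional factors `p` (`proj_mem_poleModule`). A simple pole has its numerator in the interior of
`Δ`, hence, the data being Fano, in degree zero: it is a multiple of `σ(F)`, and vanishes modulo a
further power of `p` when the constant term does (`mem_poleModule_succ`). Iteration gives the
divisibility by `p^s`.
-/

noncomputable section

namespace NaiveMirror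

/-! ### `p`-integral rational numbers and power series -/

section Integrality

variable {ι : Type*}

/-- The local ring `ℤ_(p) ⊆ ℚ` of rational numbers that are integral at `p`. -/
def pInt (p : ℕ) [Fact p.Prime] : Subring ℚ :=
  (PadicInt.subring p).comap (Rat.castHom ℚ_[p])

theorem mem_pInt {p : ℕ} [Fact p.Prime] {x : ℚ} : x ∈ pInt p ↔ ‖(x : ℚ_[p])‖ ≤ 1 := Iff.rfl

theorem intCast_mem_pInt {p : ℕ} [Fact p.Prime] (n : ℤ) : (n : ℚ) ∈ pInt p :=
  intCast_mem _ n

theorem exists_intCast_eq_of_forall_mem_pInt {x : ℚ}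
    (h : ∀ (p : ℕ) [Fact p.Prime], x ∈ pInt p) : ∃ n : ℤ, (n : ℚ) = x := by
  suffices hd : x.den = 1 from ⟨x.num, (Rat.den_eq_one_iff x).mp hd⟩
  by_contra hd
  obtain ⟨p, hp, hpd⟩ := Nat.exists_prime_and_dvd hd
  have : Fact p.Prime := ⟨hp⟩
  have hu := PadicInt.isUnit_den x (mem_pInt.mp (h p))
  rw [PadicInt.isUnit_iff] at hu
  have := (PadicInt.norm_int_lt_one_iff_dvd (p := p) (x.den : ℤ)).mpr (by exact_mod_cast hpd)
  simp only [Int.cast_natCast] at this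
  linarith

theorem inv_natCast_mem_pInt {p : ℕ} [hp : Fact p.Prime] {n : ℕ} (h : ¬ p ∣ n) :
    (n : ℚ)⁻¹ ∈ pInt p := by
  rw [mem_pInt]
  refine Padic.norm_rat_le_one ?_
  rcases Nat.eq_zero_or_pos n with rfl | hn
  · simp at h
  · rwa [Rat.inv_natCast_den_of_pos hn]

/-- An element of `ℤ_(p)` of `p`-adic norm less than one is divisible by `p`. -/
theorem div_mem_pInt_of_norm_lt_one {p : ℕ} [hp : Fact p.Prime] {x : ℚ}
    (h : ‖(x : ℚ_[p])‖ < 1) : x / p ∈ pInt p := by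
  have h1 := (Padic.norm_le_pow_iff_norm_lt_pow_add_one (x : ℚ_[p]) (-1)).mpr (by simpa using h)
  rw [mem_pInt, Rat.cast_div, Rat.cast_natCast, norm_div, Padic.norm_p]
  have hp0 : (0 : ℝ) < p := by exact_mod_cast hp.out.pos
  rw [div_le_one (by positivity)]
  simpa using h1

/-- The inclusion `ℤ_(p) → ℤ_p`. -/
def pIntToPadicInt (p : ℕ) [Fact p.Prime] : pInt p →+* ℤ_[p] where
  toFun x := ⟨((x : ℚ) : ℚ_[p]), x.2⟩
  map_zero' := Subtype.ext Rat.cast_zero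
  map_one' := Subtype.ext Rat.cast_one
  map_add' x y := Subtype.ext (Rat.cast_add (x : ℚ) y)
  map_mul' x y := Subtype.ext (Rat.cast_mul (x : ℚ) y)

/-- The reduction map `ℤ_(p) → ℤ/p`. -/
def pIntToZMod (p : ℕ) [Fact p.Prime] : pInt p →+* ZMod p :=
  PadicInt.toZMod.comp (pIntToPadicInt p)

theorem div_mem_pInt_of_toZMod_eq_zero {p : ℕ} [hp : Fact p.Prime] (x : pInt p)
    (h : pIntToZMod p x = 0) : (x : ℚ) / p ∈ pInt p := by
  refine div_mem_pInt_of_norm_lt_one ?_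
  have h1 : pIntToPadicInt p x ∈ RingHom.ker (PadicInt.toZMod (p := p)) := h
  rw [PadicInt.ker_toZMod, IsLocalRing.mem_maximalIdeal, PadicInt.mem_nonunits] at h1
  exact h1

/-- The ring of power series with coefficients in `ℤ_(p)`, as a subring of the ring of power
series over `ℚ`. -/
def pSeries (ι : Type*) (p : ℕ) [Fact p.Prime] : Subring (MvPowerSeries ι ℚ) :=
  (MvPowerSeries.map (pInt p).subtype).range

theorem mem_pSeries {p : ℕ} [Fact p.Prime] {f : MvPowerSeries ι ℚ} :
    f ∈ pSeries ι p ↔ ∀ m, MvPowerSeries.coeff m f ∈ pInt p := by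
  constructor
  · rintro ⟨g, rfl⟩ m
    rw [MvPowerSeries.coeff_map]
    exact (MvPowerSeries.coeff m g).2
  · intro h
    exact ⟨fun m => ⟨MvPowerSeries.coeff m f, h m⟩, by ext m; rfl⟩

theorem map_intCast_mem_pSeries {p : ℕ} [Fact p.Prime] (f : MvPowerSeries ι ℤ) :
    MvPowerSeries.map (Int.castRingHom ℚ) f ∈ pSeries ι p :=
  mem_pSeries.mpr fun m => by
    rw [MvPowerSeries.coeff_map]
    exact intCast_mem_pInt _

theorem coeff_natCast_mul {R : Type*} [CommRing R] (n : ℕ) (f : MvPowerSeries ι R)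
    (m : ι →₀ ℕ) :
    MvPowerSeries.coeff m ((n : MvPowerSeries ι R) * f) = n * MvPowerSeries.coeff m f := by
  rw [← map_natCast (MvPowerSeries.C (σ := ι) (R := R)), MvPowerSeries.coeff_C_mul]

theorem exists_mul_of_forall_coeff {R : Type*} [CommRing R] (n : ℕ) (f : MvPowerSeries ι R)
    (P : R → Prop) (h : ∀ m, ∃ x, P x ∧ MvPowerSeries.coeff m f = n * x) :
    ∃ g : MvPowerSeries ι R, (∀ m, P (MvPowerSeries.coeff m g)) ∧ f = n * g := by
  choose g hg using h
  let G : MvPowerSeries ι R := g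
  refine ⟨G, fun m => (hg m).1, ?_⟩
  ext m
  rw [coeff_natCast_mul, (hg m).2]
  rfl

theorem coeff_expand_cases {R : Type*} [CommRing R] {n : ℕ} (hn : n ≠ 0)
    (f : MvPowerSeries ι R) (m : ι →₀ ℕ) :
    (∃ m', m = n • m') ∨
      ((∃ i, ¬ n ∣ m i) ∧ MvPowerSeries.coeff m (MvPowerSeries.expand n hn f) = 0) := by
  by_cases h : ∀ i, n ∣ m i
  · left
    refine ⟨m.mapRange (fun a => a / n) (Nat.zero_div n), ?_⟩
    ext i
    simp [Nat.mul_div_cancel' (h i)]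
  · right
    push Not at h
    exact ⟨h, MvPowerSeries.coeff_expand_of_not_dvd n hn f h.choose_spec⟩

theorem map_expand_sub_pow_eq_zero {R : Type*} [CommRing R] (p : ℕ) [hp : Fact p.Prime]
    (π : R →+* ZMod p) (f : MvPowerSeries ι R) :
    MvPowerSeries.map π (MvPowerSeries.expand p hp.out.ne_zero f - f ^ p) = 0 := by
  have h := MvPowerSeries.map_frobenius_expand p hp.out.ne_zero (f := MvPowerSeries.map π f)
  rw [ZMod.frobenius_zmod, MvPowerSeries.map_id, RingHom.id_apply] at h
  rw [map_sub, MvPowerSeries.map_expand, h, map_pow, sub_self]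

/-- Raising to the power `p` agrees modulo `p` with substituting `x_i ↦ x_i ^ p`. -/
theorem exists_expand_eq_pow_add {p : ℕ} [hp : Fact p.Prime] (f : MvPowerSeries ι ℤ) :
    ∃ u, MvPowerSeries.expand p hp.out.ne_zero f = f ^ p + p * u := by
  obtain ⟨u, -, hu⟩ := exists_mul_of_forall_coeff p
    (MvPowerSeries.expand p hp.out.ne_zero f - f ^ p) (fun _ => True) fun m => by
      have h := congrArg (MvPowerSeries.coeff m)
        (map_expand_sub_pow_eq_zero p (Int.castRingHom (ZMod p)) f)
      rw [MvPowerSeries.coeff_map, map_zero, eq_intCast, ZMod.intCast_zmod_eq_zero_iff_dvd] at h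
      obtain ⟨x, hx⟩ := h
      exact ⟨x, trivial, hx⟩
  exact ⟨u, by rw [← hu]; ring⟩

theorem exists_expand_eq_pow_add_of_mem {p : ℕ} [hp : Fact p.Prime] {f : MvPowerSeries ι ℚ}
    (hf : f ∈ pSeries ι p) :
    ∃ u ∈ pSeries ι p, MvPowerSeries.expand p hp.out.ne_zero f = f ^ p + p * u := by
  obtain ⟨f, rfl⟩ := hf
  obtain ⟨u, hu, h⟩ := exists_mul_of_forall_coeff p
    (MvPowerSeries.map (pInt p).subtype (MvPowerSeries.expand p hp.out.ne_zero f - f ^ p))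
    (fun x => x ∈ pInt p) fun m => by
      have h := congrArg (MvPowerSeries.coeff m)
        (map_expand_sub_pow_eq_zero p (pIntToZMod p) f)
      rw [MvPowerSeries.coeff_map, map_zero] at h
      refine ⟨_, div_mem_pInt_of_toZMod_eq_zero _ h, ?_⟩
      rw [MvPowerSeries.coeff_map, mul_div_cancel₀ _ (by exact_mod_cast hp.out.ne_zero)]
      rfl
  refine ⟨u, mem_pSeries.mpr hu, ?_⟩
  rw [← h, map_sub, map_pow, MvPowerSeries.map_expand]
  ring

end Integrality

/-! ### The exponential series and the lemma of Dieudonné and Dwork -/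

section DieudonneDwork

open PowerSeries (HasSubst)

variable {ι : Type*}

theorem constantCoeff_exp_subst {g : MvPowerSeries ι ℚ}
    (hg : MvPowerSeries.constantCoeff g = 0) :
    MvPowerSeries.constantCoeff ((PowerSeries.exp ℚ).subst g) = 1 := by
  rw [PowerSeries.constantCoeff_subst (HasSubst.of_constantCoeff_zero hg),
    finsum_eq_single _ 0 fun d hd => by simp [hg, hd]]
  simp

theorem exp_subst_add {a b : MvPowerSeries ι ℚ}
    (ha : MvPowerSeries.constantCoeff a = 0) (hb : MvPowerSeries.constantCoeff b = 0) :
    (PowerSeries.exp ℚ).subst (a + b) =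
      (PowerSeries.exp ℚ).subst a * (PowerSeries.exp ℚ).subst b := by
  -- The identity is proved for two variables and then specialised.
  have key : (PowerSeries.exp ℚ).subst
      (MvPowerSeries.X 0 + MvPowerSeries.X 1 : MvPowerSeries (Fin 2) ℚ) =
      (PowerSeries.exp ℚ).subst (MvPowerSeries.X 0 : MvPowerSeries (Fin 2) ℚ) *
        (PowerSeries.exp ℚ).subst (MvPowerSeries.X 1 : MvPowerSeries (Fin 2) ℚ) := by
    ext e
    rw [PowerSeries.coeff_subst_X_zero_add_X_one, PowerSeries.coeff_subst_X_zero_subst_mul_X_one]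
    simp only [PowerSeries.coeff_exp, Algebra.algebraMap_self, RingHom.id_apply]
    have h1 : ((e 0).factorial : ℚ) ≠ 0 := by positivity
    have h2 : ((e 1).factorial : ℚ) ≠ 0 := by positivity
    have h3 : ((e 0 + e 1).factorial : ℚ) ≠ 0 := by positivity
    have h4 : (((e 0 + e 1).choose (e 0) : ℕ) : ℚ) * (e 0).factorial * (e 1).factorial =
        (e 0 + e 1).factorial := by
      have := Nat.choose_mul_factorial_mul_factorial (Nat.le_add_right (e 0) (e 1))
      rw [Nat.add_sub_cancel_left] at this
      exact_mod_cast this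
    field_simp
    linarith
  have hs : MvPowerSeries.HasSubst (![a, b] : Fin 2 → MvPowerSeries ι ℚ) :=
    MvPowerSeries.hasSubst_of_constantCoeff_zero fun i => by fin_cases i <;> simp [ha, hb]
  have hX (f : MvPowerSeries (Fin 2) ℚ) (hf : HasSubst f) :
      MvPowerSeries.subst ![a, b] ((PowerSeries.exp ℚ).subst f) =
        (PowerSeries.exp ℚ).subst (MvPowerSeries.subst ![a, b] f) :=
    MvPowerSeries.subst_comp_subst_apply hf.const hs _
  have h := congrArg (MvPowerSeries.subst ![a, b]) key
  rw [MvPowerSeries.subst_mul hs, hX _ (HasSubst.X 0), hX _ (HasSubst.X 1),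
    hX _ ((HasSubst.X 0).add (HasSubst.X 1)), MvPowerSeries.subst_add hs,
    MvPowerSeries.subst_X hs, MvPowerSeries.subst_X hs] at h
  simpa using h

theorem exp_subst_natCast_mul (n : ℕ) {a : MvPowerSeries ι ℚ}
    (ha : MvPowerSeries.constantCoeff a = 0) :
    (PowerSeries.exp ℚ).subst ((n : MvPowerSeries ι ℚ) * a) = (PowerSeries.exp ℚ).subst a ^ n := by
  induction n with
  | zero =>
    simp only [Nat.cast_zero, zero_mul, pow_zero]
    rw [PowerSeries.subst_zero_eq_C_constantCoeff]
    simp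
  | succ n ih =>
    rw [Nat.cast_succ, add_mul, one_mul, exp_subst_add (by simp [ha]) ha, ih, pow_succ]

theorem expand_exp_subst {p : ℕ} (hp : p ≠ 0) {a : MvPowerSeries ι ℚ}
    (ha : MvPowerSeries.constantCoeff a = 0) :
    MvPowerSeries.expand p hp ((PowerSeries.exp ℚ).subst a) =
      (PowerSeries.exp ℚ).subst (MvPowerSeries.expand p hp a) :=
  MvPowerSeries.expand_subst p hp (HasSubst.of_constantCoeff_zero ha).const

/-- `p ^ d / d!` is divisible by `p` in `ℤ_(p)` for every `d ≥ 1`. -/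
theorem pow_div_factorial_mem {p : ℕ} [hp : Fact p.Prime] {d : ℕ} (hd : d ≠ 0) :
    ∃ y ∈ pInt p, (p : ℚ) ^ d / d.factorial = p * y := by
  have hp0 : (p : ℚ) ≠ 0 := by exact_mod_cast hp.out.ne_zero
  have hlt := padicValNat_factorial_lt_of_ne_zero (p := p) hd
  obtain ⟨c, hc⟩ := pow_padicValNat_dvd (p := p) (n := d.factorial)
  have hpc : ¬ p ∣ c := fun h => pow_succ_padicValNat_not_dvd (p := p) d.factorial_ne_zero (by
    conv_rhs => rw [hc]
    rw [pow_succ]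
    exact mul_dvd_mul_left _ h)
  refine ⟨p ^ (d - 1 - padicValNat p d.factorial) * (c : ℚ)⁻¹,
    mul_mem (pow_mem (natCast_mem _ p) _) (inv_natCast_mem_pInt hpc), ?_⟩
  have hc0 : (c : ℚ) ≠ 0 := by
    rintro h
    rw [Nat.cast_eq_zero] at h
    simp [h] at hpc
  conv_lhs => rw [hc]
  push_cast
  have : d = padicValNat p d.factorial + 1 + (d - 1 - padicValNat p d.factorial) := by lia
  field_simp
  rw [← pow_succ, ← pow_add, ← this]

theorem exp_subst_natCast_mul_mem {p : ℕ} [hp : Fact p.Prime] {u : MvPowerSeries ι ℚ}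
    (hu : u ∈ pSeries ι p) (hu0 : MvPowerSeries.constantCoeff u = 0) :
    ∃ t ∈ pSeries ι p, (PowerSeries.exp ℚ).subst ((p : MvPowerSeries ι ℚ) * u) = 1 + p * t := by
  have hs : HasSubst ((p : MvPowerSeries ι ℚ) * u) :=
    HasSubst.of_constantCoeff_zero (by simp [hu0])
  let S : AddSubgroup ℚ := (pInt p).toAddSubgroup.map (AddMonoidHom.mulLeft (p : ℚ))
  have hS (m : ι →₀ ℕ) : MvPowerSeries.coeff m
      ((PowerSeries.exp ℚ).subst ((p : MvPowerSeries ι ℚ) * u) - 1) ∈ S := by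
    have hterm (d : ℕ) : d ≠ 0 → PowerSeries.coeff d (PowerSeries.exp ℚ) •
        MvPowerSeries.coeff m ((p * u : MvPowerSeries ι ℚ) ^ d) ∈ S := by
      intro hd
      obtain ⟨y, hy, h⟩ := pow_div_factorial_mem (p := p) hd
      refine ⟨y * MvPowerSeries.coeff m (u ^ d),
        (pInt p).mul_mem hy (mem_pSeries.mp (pow_mem hu d) m), ?_⟩
      rw [mul_pow, ← Nat.cast_pow, coeff_natCast_mul]
      simp only [AddMonoidHom.coe_mulLeft, PowerSeries.coeff_exp, Algebra.algebraMap_self,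
        RingHom.id_apply, smul_eq_mul, Nat.cast_pow]
      rw [← mul_assoc, ← h]
      ring
    have hfin := PowerSeries.coeff_subst_finite hs (PowerSeries.exp ℚ) m
    rw [map_sub, PowerSeries.coeff_subst hs, finsum_eq_sum_of_support_subset
      (s := insert 0 hfin.toFinset) _
      (fun d hd => Finset.mem_insert_of_mem (hfin.mem_toFinset.mpr hd)),
      ← Finset.add_sum_erase _ _ (Finset.mem_insert_self 0 _)]
    simp only [PowerSeries.coeff_zero_eq_constantCoeff, PowerSeries.constantCoeff_exp, pow_zero,
      one_smul, add_sub_cancel_left]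
    exact sum_mem fun d hd => hterm d (Finset.ne_of_mem_erase hd)
  obtain ⟨t, ht, h⟩ := exists_mul_of_forall_coeff p _ (fun x => x ∈ pInt p) fun m => by
    obtain ⟨x, hx, h⟩ := hS m
    exact ⟨x, hx, h.symm⟩
  exact ⟨t, mem_pSeries.mpr ht, by rw [← h]; ring⟩

theorem coeff_mul_of_forall_lt_degree {R : Type*} [CommRing R] {x : MvPowerSeries ι R}
    {m : ι →₀ ℕ} (hx : ∀ k, k.degree < m.degree → MvPowerSeries.coeff k x = 0)
    (y : MvPowerSeries ι R) :
    MvPowerSeries.coeff m (x * y) =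
      MvPowerSeries.coeff m x * MvPowerSeries.constantCoeff y := by
  classical
  rw [MvPowerSeries.coeff_mul, Finset.sum_eq_single (m, 0)]
  · simp
  · rintro ⟨a, b⟩ hab hne
    rw [Finset.HasAntidiagonal.mem_antidiagonal] at hab
    simp only at hab ⊢
    have hdeg : m.degree = a.degree + b.degree := by rw [← hab, map_add]
    rcases Nat.eq_zero_or_pos b.degree with hb | hb
    · rw [Finsupp.degree_eq_zero_iff] at hb
      subst hb
      rw [add_zero] at hab
      exact absurd (by rw [hab]) hne
    · rw [hx a (by lia), zero_mul]
  · intro h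
    simp at h

/-- The lemma of Dieudonné and Dwork: if `g(x ^ p) - p g(x)` is divisible by `p`, then `exp g`
is `p`-integral. -/
theorem exp_subst_mem_pSeries {p : ℕ} [hp : Fact p.Prime] {g u : MvPowerSeries ι ℚ}
    (hg : MvPowerSeries.constantCoeff g = 0) (hu : u ∈ pSeries ι p)
    (h : MvPowerSeries.expand p hp.out.ne_zero g = p * g + p * u) :
    (PowerSeries.exp ℚ).subst g ∈ pSeries ι p := by
  classical
  have hp0 : (p : ℚ) ≠ 0 := by exact_mod_cast hp.out.ne_zero
  have hu0 : MvPowerSeries.constantCoeff u = 0 := by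
    have := congrArg MvPowerSeries.constantCoeff h
    simpa [hg, hp0] using this
  obtain ⟨t, ht, htu⟩ := exp_subst_natCast_mul_mem hu hu0
  set e := (PowerSeries.exp ℚ).subst g with he
  have he0 : MvPowerSeries.constantCoeff e = 1 := constantCoeff_exp_subst hg
  have heq : MvPowerSeries.expand p hp.out.ne_zero e = e ^ p * (1 + p * t) := by
    rw [he, expand_exp_subst _ hg, h, exp_subst_add (by simp [hg]) (by simp [hu0]),
      exp_subst_natCast_mul p hg, htu]
  have hone : MvPowerSeries.constantCoeff (1 + p * t : MvPowerSeries ι ℚ) = 1 := by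
    rw [← htu]
    exact constantCoeff_exp_subst (by simp [hu0])
  rw [mem_pSeries]
  -- Comparing coefficients in `e(x ^ p) = e(x) ^ p (1 + p t)` determines `p` times the coefficient
  -- of `e` in degree `n` modulo `p`, once those of lower degree are known to be integral.
  suffices H : ∀ n (m : ι →₀ ℕ), m.degree = n → MvPowerSeries.coeff m e ∈ pInt p from
    fun m => H _ m rfl
  intro n
  induction n using Nat.strong_induction_on with
  | _ n ih =>
    intro m hm
    rcases Nat.eq_zero_or_pos n with rfl | hn
    · rw [Finsupp.degree_eq_zero_iff] at hm
      subst hm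
      rw [MvPowerSeries.coeff_zero_eq_constantCoeff_apply, he0]
      exact one_mem _
    let e₁ : MvPowerSeries ι ℚ := fun k => if k.degree < n then MvPowerSeries.coeff k e else 0
    have hcoeff (k : ι →₀ ℕ) : MvPowerSeries.coeff k e₁ =
        if k.degree < n then MvPowerSeries.coeff k e else 0 := rfl
    have he₁ : e₁ ∈ pSeries ι p := mem_pSeries.mpr fun k => by
      rw [hcoeff]
      split_ifs with hk
      · exact ih _ hk k rfl
      · exact zero_mem _
    set e₂ := e - e₁ with he₂
    have he₂lt (k : ι →₀ ℕ) (hk : k.degree < m.degree) : MvPowerSeries.coeff k e₂ = 0 := by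
      rw [he₂, map_sub, hcoeff, if_pos (hm ▸ hk), sub_self]
    have he₂m : MvPowerSeries.coeff m e₂ = MvPowerSeries.coeff m e := by
      rw [he₂, map_sub, hcoeff, if_neg (by lia), sub_zero]
    have he₂0 : MvPowerSeries.constantCoeff e₂ = 0 := by
      rw [← MvPowerSeries.coeff_zero_eq_constantCoeff_apply]
      exact he₂lt 0 (by simp; lia)
    have he₁0 : MvPowerSeries.constantCoeff e₁ = 1 := by
      have : e₁ = e - e₂ := by rw [he₂]; ring
      rw [this, map_sub, he0, he₂0, sub_zero]
    obtain ⟨u', hu', hfrob⟩ := exists_expand_eq_pow_add_of_mem he₁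
    obtain ⟨k, hk⟩ := Polynomial.powAddExpansion e₁ e₂ p
    have hsum : e = e₁ + e₂ := by rw [he₂]; ring
    have hleft : MvPowerSeries.coeff m (MvPowerSeries.expand p hp.out.ne_zero e) =
        MvPowerSeries.coeff m (MvPowerSeries.expand p hp.out.ne_zero e₁) := by
      rw [hsum, map_add, map_add]
      rcases coeff_expand_cases hp.out.ne_zero e₂ m with ⟨m', hm'⟩ | ⟨-, h0⟩
      · have hdeg : m.degree = p * m'.degree := by rw [hm']; simp
        have h2 := hp.out.two_le
        have : m'.degree < m.degree := by nlinarith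
        conv_lhs => rw [hm']
        rw [MvPowerSeries.coeff_expand_smul p hp.out.ne_zero e₂, he₂lt m' this, add_zero, hm']
      · rw [h0, add_zero]
    have hexp : e ^ p * (1 + p * t) = (e₁ ^ p * (1 + p * t) +
        (p : MvPowerSeries ι ℚ) * (e₂ * (e₁ ^ (p - 1) * (1 + p * t)))) +
        e₂ * (e₂ * k * (1 + p * t)) := by
      rw [hsum, hk]
      ring
    have hmain := congrArg (MvPowerSeries.coeff m) heq
    rw [hleft, hexp, map_add, map_add, coeff_natCast_mul, coeff_mul_of_forall_lt_degree he₂lt,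
      coeff_mul_of_forall_lt_degree he₂lt, he₂m, hfrob] at hmain
    simp only [map_mul MvPowerSeries.constantCoeff, map_pow MvPowerSeries.constantCoeff, he₁0,
      hone, he₂0] at hmain
    have hfin : MvPowerSeries.coeff m e = MvPowerSeries.coeff m (u' - e₁ ^ p * t) := by
      have h2 : e₁ ^ p * (1 + p * t) = e₁ ^ p + p * (e₁ ^ p * t) := by ring
      rw [h2, map_add, map_add, coeff_natCast_mul, coeff_natCast_mul] at hmain
      rw [map_sub]
      apply mul_left_cancel₀ hp0
      simp only [one_pow, mul_one, zero_mul, mul_zero, add_zero] at hmain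
      linarith
    rw [hfin]
    exact mem_pSeries.mp (sub_mem hu' (mul_mem (pow_mem he₁ p) ht)) m

end DieudonneDwork

/-! ### Supports of power series and extraction of homogeneous parts -/

section Support

variable {ι M R : Type*} [AddCommGroup M] [CommRing R]

/-- All exponents of monomials occurring in `f` satisfy `P`. -/
def SuppOn (f : MvPowerSeries ι R) (P : (ι →₀ ℕ) → Prop) : Prop :=
  ∀ m, MvPowerSeries.coeff m f ≠ 0 → P m

theorem SuppOn.mono {f : MvPowerSeries ι R} {P Q : (ι →₀ ℕ) → Prop} (hf : SuppOn f P)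
    (h : ∀ m, P m → Q m) : SuppOn f Q := fun m hm => h m (hf m hm)

theorem SuppOn.mul {f g : MvPowerSeries ι R} {P Q S : (ι →₀ ℕ) → Prop} (hf : SuppOn f P)
    (hg : SuppOn g Q) (h : ∀ a b, P a → Q b → S (a + b)) : SuppOn (f * g) S := by
  classical
  intro m hm
  rw [MvPowerSeries.coeff_mul] at hm
  obtain ⟨⟨a, b⟩, hab, hne⟩ := Finset.exists_ne_zero_of_sum_ne_zero hm
  rw [← Finset.HasAntidiagonal.mem_antidiagonal.mp hab]
  exact h a b (hf a (left_ne_zero_of_mul hne)) (hg b (right_ne_zero_of_mul hne))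

theorem suppOn_one {P : (ι →₀ ℕ) → Prop} (h : P 0) : SuppOn (1 : MvPowerSeries ι R) P := by
  classical
  intro m hm
  by_cases hm0 : m = 0
  · rwa [hm0]
  · exact absurd (by rw [MvPowerSeries.coeff_one, if_neg hm0]) hm

theorem suppOn_expand {f : MvPowerSeries ι R} {P Q : (ι →₀ ℕ) → Prop} {n : ℕ} (hn : n ≠ 0)
    (hf : SuppOn f P) (h : ∀ m, P m → Q (n • m)) : SuppOn (MvPowerSeries.expand n hn f) Q := by
  intro m hm
  rcases coeff_expand_cases hn f m with ⟨m', rfl⟩ | ⟨-, h0⟩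
  · rw [MvPowerSeries.coeff_expand_smul] at hm
    exact h m' (hf m' hm)
  · exact absurd h0 hm

open Classical in
/-- Given a grading of the monomials by `V`, the part of a power series made up of the monomials
whose degree lies in the subgroup `L`. -/
def proj (V : (ι →₀ ℕ) →+ M) (L : AddSubgroup M) : MvPowerSeries ι R →+ MvPowerSeries ι R where
  toFun f := fun m => if V m ∈ L then MvPowerSeries.coeff m f else 0
  map_zero' := by
    ext m
    change (if V m ∈ L then MvPowerSeries.coeff m (0 : MvPowerSeries ι R) else 0) = 0
    simp
  map_add' f g := by
    ext m
    change (if V m ∈ L then MvPowerSeries.coeff m (f + g) else 0) =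
      (if V m ∈ L then MvPowerSeries.coeff m f else 0) +
        (if V m ∈ L then MvPowerSeries.coeff m g else 0)
    split_ifs <;> simp

open Classical in
theorem coeff_proj (V : (ι →₀ ℕ) →+ M) (L : AddSubgroup M) (f : MvPowerSeries ι R)
    (m : ι →₀ ℕ) : MvPowerSeries.coeff m (proj V L f) =
      if V m ∈ L then MvPowerSeries.coeff m f else 0 := rfl

variable {V : (ι →₀ ℕ) →+ M} {L : AddSubgroup M}

theorem suppOn_proj (f : MvPowerSeries ι R) : SuppOn (proj V L f) (fun m => V m ∈ L) := by
  intro m hm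
  by_contra h
  exact hm (by rw [coeff_proj, if_neg h])

theorem SuppOn.proj {f : MvPowerSeries ι R} {P : (ι →₀ ℕ) → Prop} (hf : SuppOn f P) :
    SuppOn (proj V L f) P := by
  intro m hm
  rw [coeff_proj] at hm
  exact hf m fun h => hm (by simp [h])

theorem SuppOn.proj_eq {f : MvPowerSeries ι R} (hf : SuppOn f (fun m => V m ∈ L)) :
    NaiveMirror.proj V L f = f := by
  ext m
  rw [coeff_proj]
  split_ifs with h
  · rfl
  · by_contra h0
    exact h (hf m (Ne.symm h0))

theorem proj_mul {y : MvPowerSeries ι R} (hy : SuppOn y (fun m => V m ∈ L))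
    (x : MvPowerSeries ι R) : proj V L (x * y) = proj V L x * y := by
  classical
  ext m
  rw [coeff_proj, MvPowerSeries.coeff_mul, MvPowerSeries.coeff_mul]
  split_ifs with h
  · refine Finset.sum_congr rfl fun ab hab => ?_
    rw [coeff_proj]
    split_ifs with ha
    · rfl
    · by_cases hb : MvPowerSeries.coeff ab.2 y = 0
      · rw [hb, mul_zero, mul_zero]
      · rw [← Finset.HasAntidiagonal.mem_antidiagonal.mp hab, map_add] at h
        exact absurd ((L.add_mem_cancel_right (hy _ hb)).mp h) ha
  · symm
    refine Finset.sum_eq_zero fun ab hab => ?_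
    rw [coeff_proj]
    split_ifs with ha
    · by_cases hb : MvPowerSeries.coeff ab.2 y = 0
      · rw [hb, mul_zero]
      · refine absurd ?_ h
        rw [← Finset.HasAntidiagonal.mem_antidiagonal.mp hab, map_add]
        exact L.add_mem ha (hy _ hb)
    · rw [zero_mul]

theorem proj_natCast_mul (n : ℕ) (x : MvPowerSeries ι R) :
    proj V L ((n : MvPowerSeries ι R) * x) = (n : MvPowerSeries ι R) * proj V L x := by
  rw [← nsmul_eq_mul, map_nsmul, nsmul_eq_mul]

theorem proj_proj {L' : AddSubgroup M} (h : L' ≤ L) (x : MvPowerSeries ι R) :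
    proj V L' (proj V L x) = proj V L' x := by
  ext m
  simp only [coeff_proj]
  split_ifs with h1 h2
  · rfl
  · exact absurd (h h1) h2
  · rfl

theorem constantCoeff_proj (x : MvPowerSeries ι R) :
    MvPowerSeries.constantCoeff (proj V L x) = MvPowerSeries.constantCoeff x := by
  rw [← MvPowerSeries.coeff_zero_eq_constantCoeff_apply, coeff_proj, if_pos (by simp)]
  rfl

theorem proj_bot_expand {n : ℕ} (hn : n ≠ 0) (hM : ∀ x : M, n • x = 0 → x = 0)
    (x : MvPowerSeries ι R) : proj V ⊥ (MvPowerSeries.expand n hn x) =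
      MvPowerSeries.expand n hn (proj V ⊥ x) := by
  ext m
  rw [coeff_proj]
  rcases coeff_expand_cases hn x m with ⟨m', rfl⟩ | ⟨⟨i, hi⟩, h0⟩
  · rw [MvPowerSeries.coeff_expand_smul, MvPowerSeries.coeff_expand_smul, coeff_proj, map_nsmul]
    have h : n • V m' ∈ (⊥ : AddSubgroup M) ↔ V m' ∈ (⊥ : AddSubgroup M) :=
      ⟨fun h => hM _ h, fun h => AddSubgroup.nsmul_mem _ h n⟩
    by_cases h' : V m' ∈ (⊥ : AddSubgroup M)
    · rw [if_pos h', if_pos (h.mpr h')]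
    · rw [if_neg h', if_neg fun h0 => h' (h.mp h0)]
  · rw [h0, ite_self, MvPowerSeries.coeff_expand_of_not_dvd n hn _ hi]

/-- The inverse of a series of degree zero has degree zero. -/
theorem suppOn_bot_of_mul_eq_one {x y : MvPowerSeries ι R}
    (hx : SuppOn x (fun m => V m ∈ (⊥ : AddSubgroup M))) (h : y * x = 1) :
    SuppOn y (fun m => V m ∈ (⊥ : AddSubgroup M)) := by
  have h1 : proj V ⊥ y * x = 1 := by
    rw [← proj_mul hx, h]
    exact (suppOn_one (by simp)).proj_eq
  have h2 : y = proj V ⊥ y := by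
    calc y = y * (proj V ⊥ y * x) := by rw [h1, mul_one]
      _ = proj V ⊥ y * (y * x) := by ring
      _ = proj V ⊥ y := by rw [h, mul_one]
  rw [h2]
  exact suppOn_proj y

end Support

/-! ### Expansions of rational functions with poles along a hypersurface -/

section Congruence

variable {ι M : Type*} [AddCommGroup M]

/-- A function on a lattice with the formal properties of the gauge of a polytope that has the
origin as its only interior lattice point. -/
structure IsFanoGauge (N : M → ℝ) : Prop where
  add_le : ∀ x y, N (x + y) ≤ N x + N y
  nsmul : ∀ (n : ℕ) x, N (n • x) = n * N x
  eq_zero_of_lt_one : ∀ x, N x < 1 → x = 0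

theorem IsFanoGauge.zero {N : M → ℝ} (hN : IsFanoGauge N) : N 0 = 0 := by
  simpa using hN.nsmul 0 0

theorem IsFanoGauge.eq_zero_of_nsmul {N : M → ℝ} (hN : IsFanoGauge N) {n : ℕ} (hn : n ≠ 0) (x : M)
    (h : n • x = 0) : x = 0 := by
  have h1 := hN.nsmul n x
  rw [h, hN.zero] at h1
  have h2 : N x = 0 := by
    rcases mul_eq_zero.mp h1.symm with h3 | h3
    · exact absurd (by exact_mod_cast h3) hn
    · exact h3
  exact hN.eq_zero_of_lt_one x (by rw [h2]; exact one_pos)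

/-- The subgroup `p ^ s M` of `M`. -/
def level (M : Type*) [AddCommGroup M] (p s : ℕ) : AddSubgroup M :=
  (nsmulAddMonoidHom (α := M) (p ^ s)).range

theorem mem_level {p s : ℕ} {x : M} : x ∈ level M p s ↔ ∃ y, p ^ s • y = x := Iff.rfl

theorem level_succ_le (p s : ℕ) : level M p (s + 1) ≤ level M p s := by
  rintro x ⟨y, rfl⟩
  refine ⟨p • y, ?_⟩
  simp [pow_succ, mul_smul]

theorem IsFanoGauge.eq_zero_of_mem_level {N : M → ℝ} (hN : IsFanoGauge N) {p s : ℕ} (hp : p ≠ 0)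
    {x : M} (hx : x ∈ level M p s) (h : N x < (p : ℝ) ^ s) : x = 0 := by
  obtain ⟨y, rfl⟩ := mem_level.mp hx
  rw [hN.nsmul] at h
  have hpos : (0 : ℝ) < (p : ℝ) ^ s := by positivity
  push_cast at h
  rw [hN.eq_zero_of_lt_one y (by nlinarith), smul_zero]

variable (p : ℕ) [hp : Fact p.Prime]

/-- The substitution `x_i ↦ x_i ^ (p ^ s)`. -/
def frob (s : ℕ) : MvPowerSeries ι ℤ →ₐ[ℤ] MvPowerSeries ι ℤ :=
  MvPowerSeries.expand (p ^ s) (pow_ne_zero s hp.out.ne_zero)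

theorem frob_zero (x : MvPowerSeries ι ℤ) : frob p 0 x = x := by
  simp [frob]

theorem frob_one (x : MvPowerSeries ι ℤ) :
    frob p 1 x = MvPowerSeries.expand p hp.out.ne_zero x := by
  simp [frob]

theorem frob_succ (s : ℕ) (x : MvPowerSeries ι ℤ) :
    frob p (s + 1) x = MvPowerSeries.expand p hp.out.ne_zero (frob p s x) := by
  rw [frob, frob, ← MvPowerSeries.expand_mul]
  simp [pow_succ']

theorem suppOn_frob (V : (ι →₀ ℕ) →+ M) (s : ℕ) (x : MvPowerSeries ι ℤ) :
    SuppOn (frob p s x) (fun m => V m ∈ level M p s) :=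
  suppOn_expand _ (P := fun _ => True) (fun _ _ => trivial)
    fun m _ => ⟨V m, by simp⟩

/-- The series `p ^ t A F_s ^ (k + 1)` with `t ≥ max (s + k - 1) a`, where `F_s = F(x ^ (p ^ s))`
is the inverse of a Laurent polynomial, and the numerator `A` is supported in degrees divisible by
`p ^ s` and lying in the interior of the polytope scaled by `p ^ s (k + 1)`. The factor `p ^ t`
grows with the order of the pole. All multiples of `p ^ c` are included, so that only finitely many pole
orders matter. -/
inductive PoleGenerator (V : (ι →₀ ℕ) →+ M) (N : M → ℝ) (F : MvPowerSeries ι ℤ) (s a c : ℕ) :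
    MvPowerSeries ι ℤ → Prop
  | pole (k t : ℕ) (A : MvPowerSeries ι ℤ) (hst : s + k ≤ t + 1) (ha : a ≤ t)
      (hV : SuppOn A (fun m => V m ∈ level M p s))
      (hN : SuppOn A (fun m => N (V m) < (p : ℝ) ^ s * (k + 1 : ℕ))) :
      PoleGenerator V N F s a c (((p ^ t : ℕ) : MvPowerSeries ι ℤ) * (A * frob p s F ^ (k + 1)))
  | small (x : MvPowerSeries ι ℤ) :
      PoleGenerator V N F s a c (((p ^ c : ℕ) : MvPowerSeries ι ℤ) * x)

/-- The group of series spanned by `PoleGenerator`. -/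
def poleModule (V : (ι →₀ ℕ) →+ M) (N : M → ℝ) (F : MvPowerSeries ι ℤ) (s a c : ℕ) :
    AddSubgroup (MvPowerSeries ι ℤ) :=
  AddSubgroup.closure {W | PoleGenerator p V N F s a c W}

variable {p} {V : (ι →₀ ℕ) →+ M} {N : M → ℝ} {f F : MvPowerSeries ι ℤ}

theorem PoleGenerator.mem {s a c : ℕ} {W : MvPowerSeries ι ℤ}
    (h : PoleGenerator p V N F s a c W) : W ∈ poleModule p V N F s a c :=
  AddSubgroup.subset_closure h

theorem exists_eq_mul_of_mem_poleModule {s c : ℕ} (hsc : s ≤ c) {W : MvPowerSeries ι ℤ}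
    (hW : W ∈ poleModule p V N F s s c) : ∃ x, W = ((p ^ s : ℕ) : MvPowerSeries ι ℤ) * x := by
  induction hW using AddSubgroup.closure_induction with
  | mem W hW =>
    cases hW with
    | pole k t A hst ha hV hN =>
      refine ⟨((p ^ (t - s) : ℕ) : MvPowerSeries ι ℤ) * (A * frob p s F ^ (k + 1)), ?_⟩
      rw [← mul_assoc ((p ^ s : ℕ) : MvPowerSeries ι ℤ), ← Nat.cast_mul, ← pow_add,
        Nat.add_sub_cancel' ha]
    | small x =>
      refine ⟨((p ^ (c - s) : ℕ) : MvPowerSeries ι ℤ) * x, ?_⟩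
      rw [← mul_assoc ((p ^ s : ℕ) : MvPowerSeries ι ℤ), ← Nat.cast_mul, ← pow_add,
        Nat.add_sub_cancel' hsc]
  | zero => exact ⟨0, by simp⟩
  | add x y _ _ hx hy =>
    obtain ⟨x', rfl⟩ := hx
    obtain ⟨y', rfl⟩ := hy
    exact ⟨x' + y', by ring⟩
  | neg x _ hx =>
    obtain ⟨x', rfl⟩ := hx
    exact ⟨-x', by ring⟩

theorem suppOn_frob_gauge (hN : IsFanoGauge N) (hf : SuppOn f (fun m => N (V m) ≤ 1)) (s : ℕ) :
    SuppOn (frob p s f) (fun m => N (V m) ≤ (p : ℝ) ^ s) :=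
  suppOn_expand _ hf fun m hm => by
    rw [map_nsmul, hN.nsmul]
    push_cast
    exact mul_le_of_le_one_right (by positivity) hm

theorem suppOn_pow_gauge {R : Type*} [CommRing R] (hN : IsFanoGauge N) {x : MvPowerSeries ι R}
    {b : ℝ} (hx : SuppOn x (fun m => N (V m) ≤ b)) (n : ℕ) :
    SuppOn (x ^ n) (fun m => N (V m) ≤ n * b) := by
  induction n with
  | zero => exact suppOn_one (by simp [hN.zero])
  | succ n ih =>
    rw [pow_succ]
    refine ih.mul hx fun u v hu hv => ?_
    rw [map_add]
    refine (hN.add_le _ _).trans ?_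
    push_cast
    linarith

/-- The Frobenius congruence `f_s ^ p ≡ f_{s+1}` modulo `p`, with a bound on the support of the
error term. -/
theorem exists_frob_pow_eq (hN : IsFanoGauge N) (hf : SuppOn f (fun m => N (V m) ≤ 1)) (s : ℕ) :
    ∃ G : MvPowerSeries ι ℤ, frob p (s + 1) f = frob p s f ^ p + p * G ∧
      SuppOn G (fun m => N (V m) ≤ (p : ℝ) ^ (s + 1)) := by
  obtain ⟨G, hG⟩ := exists_expand_eq_pow_add (p := p) (frob p s f)
  rw [← frob_succ] at hG
  refine ⟨G, hG, fun m hm => ?_⟩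
  by_contra h
  have h1 : MvPowerSeries.coeff m (frob p (s + 1) f) = 0 := by
    by_contra h0
    exact h (suppOn_frob_gauge hN hf (s + 1) m h0)
  have h2 : MvPowerSeries.coeff m (frob p s f ^ p) = 0 := by
    by_contra h0
    have := suppOn_pow_gauge hN (suppOn_frob_gauge hN hf s) p m h0
    rw [← pow_succ'] at this
    exact h this
  have h3 := congrArg (MvPowerSeries.coeff m) hG
  rw [map_add, h1, h2, zero_add, coeff_natCast_mul] at h3
  rcases mul_eq_zero.mp h3.symm with h4 | h4
  · exact hp.out.ne_zero (by exact_mod_cast h4)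
  · exact hm h4

/-- A pole of order `p m` along `f_s` is rewritten in terms of poles along `f_{s+1}` by repeated
use of `F_s ^ p = F_{s+1} + p G F_{s+1} F_s ^ p`. -/
theorem proj_pole_mem (hN : IsFanoGauge N) (hf : SuppOn f (fun m => N (V m) ≤ 1))
    (hfF : f * F = 1) (s c : ℕ) (n : ℕ) : ∀ (m j t : ℕ) (B : MvPowerSeries ι ℤ),
      c ≤ t + n → 1 ≤ m + j → s + (m + j) ≤ t + 1 →
      SuppOn B (fun k => N (V k) < (p : ℝ) ^ (s + 1) * (m + j : ℕ)) →
      proj V (level M p (s + 1)) (((p ^ t : ℕ) : MvPowerSeries ι ℤ) *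
        (B * frob p (s + 1) F ^ j * frob p s F ^ (p * m))) ∈
          poleModule p V N F (s + 1) s c := by
  obtain ⟨G, hG, hGs⟩ := exists_frob_pow_eq (p := p) hN hf s
  have hs1 : frob p s f * frob p s F = 1 := by rw [← map_mul, hfF, map_one]
  have hs2 : frob p (s + 1) f * frob p (s + 1) F = 1 := by rw [← map_mul, hfF, map_one]
  have hrec : frob p s F ^ p =
      frob p (s + 1) F + p * (G * frob p (s + 1) F * frob p s F ^ p) := by
    have h1 : frob p s f ^ p * frob p s F ^ p = 1 := by rw [← mul_pow, hs1, one_pow]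
    calc frob p s F ^ p = (frob p (s + 1) f * frob p (s + 1) F) * frob p s F ^ p := by
          rw [hs2, one_mul]
      _ = (frob p s f ^ p * frob p s F ^ p) * frob p (s + 1) F +
          p * (G * frob p (s + 1) F * frob p s F ^ p) := by rw [hG]; ring
      _ = _ := by rw [h1, one_mul]
  have hpow (j : ℕ) : SuppOn (frob p (s + 1) F ^ j) (fun m => V m ∈ level M p (s + 1)) := by
    rw [← map_pow]
    exact suppOn_frob p V _ _
  induction n with
  | zero =>
    intro m j t B hc _ _ _
    rw [proj_natCast_mul, show t = c + (t - c) by lia, pow_add, Nat.cast_mul, mul_assoc]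
    exact (PoleGenerator.small _).mem
  | succ n ihn =>
    intro m
    induction m with
    | zero =>
      intro j t B _ hj hst hB
      obtain ⟨k, rfl⟩ : ∃ k, j = k + 1 := ⟨j - 1, by lia⟩
      rw [proj_natCast_mul, mul_zero, pow_zero, mul_one, proj_mul (hpow _)]
      refine (PoleGenerator.pole k t _ (by lia) (by lia) (suppOn_proj B) ?_).mem
      simpa only [zero_add] using hB.proj
    | succ m ihm =>
      intro j t B hc hj hst hB
      have hsplit : ((p ^ t : ℕ) : MvPowerSeries ι ℤ) *
          (B * frob p (s + 1) F ^ j * frob p s F ^ (p * (m + 1))) =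
          ((p ^ t : ℕ) : MvPowerSeries ι ℤ) *
            (B * frob p (s + 1) F ^ (j + 1) * frob p s F ^ (p * m)) +
          ((p ^ (t + 1) : ℕ) : MvPowerSeries ι ℤ) *
            (B * G * frob p (s + 1) F ^ (j + 1) * frob p s F ^ (p * (m + 1))) := by
        rw [mul_add, mul_one, pow_add (frob p s F)]
        conv_lhs => rw [hrec]
        push_cast
        ring
      rw [hsplit, map_add]
      refine add_mem (ihm (j + 1) t B hc (by lia) (by lia) ?_)
        (ihn (m + 1) (j + 1) (t + 1) (B * G) (by lia) (by lia) (by lia) ?_)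
      · rwa [show m + (j + 1) = m + 1 + j by lia]
      · refine hB.mul hGs fun u v hu hv => ?_
        rw [map_add]
        refine (hN.add_le _ _).trans_lt ?_
        rw [← add_assoc, Nat.cast_succ, mul_add, mul_one]
        linarith

/-- Keeping the monomials of degree divisible by `p ^ (s + 1)` preserves pole orders up to
multiples of `p`; poles of order greater than one gain a factor `p`. The only exception is the
simple pole, which is why the last but one parameter stays equal to `s`. -/
theorem proj_mem_poleModule (hN : IsFanoGauge N) (hf : SuppOn f (fun m => N (V m) ≤ 1))
    (hfF : f * F = 1) {s c : ℕ} {W : MvPowerSeries ι ℤ} (hW : W ∈ poleModule p V N F s s c) :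
    proj V (level M p (s + 1)) W ∈ poleModule p V N F (s + 1) s c := by
  induction hW using AddSubgroup.closure_induction with
  | mem W hW =>
    cases hW with
    | pole k t A hst ha hV hA =>
      have hp2 := hp.out.two_le
      have hdiv : k / p * p + k % p = k := Nat.div_add_mod' k p
      have hmod : k % p < p := Nat.mod_lt _ hp.out.pos
      obtain ⟨l, hl⟩ : ∃ l, k + 1 + l = p * (k / p + 1) :=
        ⟨p * (k / p + 1) - (k + 1), by rw [mul_add, mul_comm p]; lia⟩
      have hs1 : frob p s f ^ l * frob p s F ^ l = 1 := by
        rw [← mul_pow, ← map_mul, hfF, map_one, one_pow]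
      have hkt : s + k / p ≤ t := by
        rcases Nat.eq_zero_or_pos k with rfl | hk
        · simpa using ha
        · have : k / p < k := Nat.div_lt_self hk hp2
          lia
      -- Multiplying by `f_s ^ l` makes the order of the pole divisible by `p`.
      have hrw : ((p ^ t : ℕ) : MvPowerSeries ι ℤ) * (A * frob p s F ^ (k + 1)) =
          ((p ^ t : ℕ) : MvPowerSeries ι ℤ) * (A * frob p s f ^ l * frob p (s + 1) F ^ 0 *
            frob p s F ^ (p * (k / p + 1))) := by
        rw [← hl, pow_add _ (k + 1) l]
        calc _ = ((p ^ t : ℕ) : MvPowerSeries ι ℤ) *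
              (A * (frob p s f ^ l * frob p s F ^ l) * frob p s F ^ (k + 1)) := by
              rw [hs1, mul_one]
          _ = _ := by ring
      rw [hrw]
      refine proj_pole_mem hN hf hfF s c c _ 0 t _ (by lia) (by lia) (by lia) ?_
      refine hA.mul (suppOn_pow_gauge hN (suppOn_frob_gauge hN hf s) l) fun u v hu hv => ?_
      rw [map_add]
      refine (hN.add_le _ _).trans_lt ?_
      have : (p : ℝ) ^ (s + 1) * (k / p + 1 + 0 : ℕ) = (p : ℝ) ^ s * ((k + 1 : ℕ) + l) := by
        rw [← Nat.cast_add, hl, pow_succ]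
        push_cast
        ring
      rw [this]
      linarith
    | small x =>
      rw [proj_natCast_mul]
      exact (PoleGenerator.small _).mem
  | zero => rw [map_zero]; exact zero_mem _
  | add x y _ _ hx hy => rw [map_add]; exact add_mem hx hy
  | neg x _ hx => rw [map_neg]; exact neg_mem hx

/-- The polar part of lowest order is a multiple of `F_{s+1}` by a series of degree zero, because
the origin is the only interior lattice point of the polytope. -/
theorem exists_sub_mem_poleModule (hN : IsFanoGauge N) {s c : ℕ}
    {W : MvPowerSeries ι ℤ} (hW : W ∈ poleModule p V N F (s + 1) s c) :
    ∃ r : MvPowerSeries ι ℤ, SuppOn r (fun m => V m ∈ (⊥ : AddSubgroup M)) ∧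
      W - ((p ^ s : ℕ) : MvPowerSeries ι ℤ) * (r * frob p (s + 1) F) ∈
        poleModule p V N F (s + 1) (s + 1) c := by
  have hzero : SuppOn (0 : MvPowerSeries ι ℤ) (fun m => V m ∈ (⊥ : AddSubgroup M)) :=
    fun m hm => absurd (map_zero (MvPowerSeries.coeff m)) hm
  induction hW using AddSubgroup.closure_induction with
  | mem W hW =>
    cases hW with
    | pole k t A hst ha hV hA =>
      by_cases hts : s + 1 ≤ t
      · refine ⟨0, hzero, ?_⟩
        rw [zero_mul, mul_zero, sub_zero]
        exact (PoleGenerator.pole k t A hst hts hV hA).mem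
      · obtain rfl : t = s := by lia
        obtain rfl : k = 0 := by lia
        refine ⟨A, fun m hm => ?_, ?_⟩
        · refine AddSubgroup.mem_bot.mpr
            (hN.eq_zero_of_mem_level hp.out.ne_zero (hV m hm) ?_)
          simpa using hA m hm
        · rw [zero_add, pow_one, sub_self]
          exact zero_mem _
    | small x =>
      refine ⟨0, hzero, ?_⟩
      rw [zero_mul, mul_zero, sub_zero]
      exact (PoleGenerator.small x).mem
  | zero => exact ⟨0, hzero, by simp⟩
  | add x y _ _ hx hy =>
    obtain ⟨r, hr, hx⟩ := hx
    obtain ⟨r', hr', hy⟩ := hy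
    refine ⟨r + r', fun m hm => ?_, ?_⟩
    · by_contra h
      rw [map_add, not_not.mp fun h0 => h (hr m h0), not_not.mp fun h0 => h (hr' m h0),
        add_zero] at hm
      exact hm rfl
    · convert add_mem hx hy using 1
      ring
  | neg x _ hx =>
    obtain ⟨r, hr, hx⟩ := hx
    refine ⟨-r, fun m hm => hr m fun h => hm (by rw [map_neg, h, neg_zero]), ?_⟩
    convert neg_mem hx using 1
    ring

theorem exists_mul_eq_one {x : MvPowerSeries ι ℤ} (hx : MvPowerSeries.constantCoeff x = 1) :
    ∃ y, y * x = 1 :=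
  ⟨_, MvPowerSeries.invOfUnit_mul x 1 (by simpa using hx)⟩

/-- If the part of degree zero vanishes, so does the polar part of lowest order modulo a further
power of `p`. -/
theorem mem_poleModule_succ (hN : IsFanoGauge N)
    (hF1 : MvPowerSeries.constantCoeff F = 1) {s c : ℕ} (hsc : s + 1 ≤ c)
    {W : MvPowerSeries ι ℤ} (hW : W ∈ poleModule p V N F (s + 1) s c) (hW0 : proj V ⊥ W = 0) :
    W ∈ poleModule p V N F (s + 1) (s + 1) c := by
  obtain ⟨r, hr, hd⟩ := exists_sub_mem_poleModule hN hW
  obtain ⟨x, hx⟩ := exists_eq_mul_of_mem_poleModule hsc hd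
  have hX : MvPowerSeries.constantCoeff (proj V ⊥ (frob p (s + 1) F)) = 1 := by
    rw [constantCoeff_proj, frob, MvPowerSeries.constantCoeff_expand, hF1]
  obtain ⟨y, hy⟩ := exists_mul_eq_one hX
  have hybot := suppOn_bot_of_mul_eq_one (V := V) (suppOn_proj _) hy
  have h1 := congrArg (proj V (⊥ : AddSubgroup M)) hx
  rw [map_sub, hW0, proj_natCast_mul, proj_natCast_mul, mul_comm r, proj_mul hr, zero_sub] at h1
  have hp0 : ((p ^ s : ℕ) : MvPowerSeries ι ℤ) ≠ 0 := by
    intro h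
    have h0 := congrArg MvPowerSeries.constantCoeff h
    rw [map_natCast, map_zero] at h0
    exact pow_ne_zero s hp.out.ne_zero (by exact_mod_cast h0)
  -- Dividing by `p ^ s` and by the degree zero part of `F_{s+1}` shows that `p` divides `r`.
  have h2 : r = p * (-(proj V ⊥ x * y)) := by
    apply mul_left_cancel₀ hp0
    have h3 : ((p ^ s : ℕ) : MvPowerSeries ι ℤ) * (y * proj V ⊥ (frob p (s + 1) F) * r) =
        -(((p ^ (s + 1) : ℕ) : MvPowerSeries ι ℤ) * proj V ⊥ x) * y := by
      rw [← h1]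
      ring
    rw [hy, one_mul] at h3
    rw [h3, pow_succ, Nat.cast_mul]
    ring
  have h4 : ((p ^ s : ℕ) : MvPowerSeries ι ℤ) * (r * frob p (s + 1) F) =
      ((p ^ (s + 1) : ℕ) : MvPowerSeries ι ℤ) *
        (proj V ⊥ (-x * y) * frob p (s + 1) F ^ (0 + 1)) := by
    rw [h2, proj_mul hybot, map_neg, pow_succ p, Nat.cast_mul, zero_add, pow_one]
    ring
  rw [h4] at hd
  have h5 : ((p ^ (s + 1) : ℕ) : MvPowerSeries ι ℤ) *
      (proj V ⊥ (-x * y) * frob p (s + 1) F ^ (0 + 1)) ∈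
        poleModule p V N F (s + 1) (s + 1) c := by
    refine (PoleGenerator.pole 0 (s + 1) _ (by lia) le_rfl ?_ ?_).mem
    · refine (suppOn_proj _).mono fun m hm => ?_
      rw [AddSubgroup.mem_bot.mp hm]
      exact zero_mem _
    · refine (suppOn_proj _).mono fun m hm => ?_
      rw [AddSubgroup.mem_bot.mp hm, hN.zero]
      have := hp.out.pos
      positivity
  simpa using add_mem hd h5

theorem self_mem_poleModule (hN : IsFanoGauge N) (c : ℕ) : F ∈ poleModule p V N F 0 0 c := by
  have h : PoleGenerator p V N F 0 0 c
      (((p ^ 0 : ℕ) : MvPowerSeries ι ℤ) * (1 * frob p 0 F ^ (0 + 1))) := by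
    refine PoleGenerator.pole 0 0 1 (Nat.zero_le _) le_rfl (suppOn_one ?_) (suppOn_one ?_)
    · rw [map_zero]
      exact zero_mem _
    · rw [map_zero, hN.zero]
      simp
  simpa [frob_zero] using h.mem

theorem mul_frob_mem_poleModule (hN : IsFanoGauge N) {l : MvPowerSeries ι ℤ}
    (hl : SuppOn l (fun m => V m ∈ (⊥ : AddSubgroup M))) (c : ℕ) :
    l * frob p 1 F ∈ poleModule p V N F 1 0 c := by
  have h : PoleGenerator p V N F 1 0 c
      (((p ^ 0 : ℕ) : MvPowerSeries ι ℤ) * (l * frob p 1 F ^ (0 + 1))) := by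
    refine PoleGenerator.pole 0 0 l le_rfl le_rfl (hl.mono fun m hm => ?_)
      (hl.mono fun m hm => ?_)
    · rw [AddSubgroup.mem_bot.mp hm]
      exact zero_mem _
    · rw [AddSubgroup.mem_bot.mp hm, hN.zero]
      simpa using hp.out.pos
  simpa using h.mem

/-- Let `F` be the inverse of a Laurent polynomial whose Newton polytope has the origin as its
only interior lattice point, and let `λ = F_0(x) / F_0(x ^ p)`, with `F_0` the part of degree
zero of `F`. Then the coefficients of `F(x) - λ F(x ^ p)` at monomials of degree divisible by
`p ^ s` are themselves divisible by `p ^ s`. -/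
theorem dwork_congruence (p : ℕ) [hp : Fact p.Prime] (hN : IsFanoGauge N)
    (hf : SuppOn f (fun m => N (V m) ≤ 1)) (hfF : f * F = 1)
    (hF1 : MvPowerSeries.constantCoeff F = 1) :
    ∃ l : MvPowerSeries ι ℤ, SuppOn l (fun m => V m ∈ (⊥ : AddSubgroup M)) ∧
      proj V ⊥ F = l * MvPowerSeries.expand p hp.out.ne_zero (proj V ⊥ F) ∧
      ∀ s m, V m ∈ level M p (s + 1) →
        ((p ^ (s + 1) : ℕ) : ℤ) ∣
          MvPowerSeries.coeff m (F - l * MvPowerSeries.expand p hp.out.ne_zero F) := by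
  set X := proj V ⊥ F with hX
  have hXF := proj_bot_expand (V := V) hp.out.ne_zero
    (fun x => hN.eq_zero_of_nsmul hp.out.ne_zero x) F
  obtain ⟨y, hy⟩ := exists_mul_eq_one
    (x := MvPowerSeries.expand p hp.out.ne_zero X)
    (by rw [MvPowerSeries.constantCoeff_expand, hX, constantCoeff_proj, hF1])
  have hybot := suppOn_bot_of_mul_eq_one (V := V) (by rw [← hXF]; exact suppOn_proj _) hy
  have hl : SuppOn (X * y) (fun m => V m ∈ (⊥ : AddSubgroup M)) :=
    (suppOn_proj F).mul hybot fun a b ha hb => by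
      rw [map_add]
      exact add_mem ha hb
  have hlX : X = X * y * MvPowerSeries.expand p hp.out.ne_zero X := by
    rw [mul_assoc, hy, mul_one]
  refine ⟨X * y, hl, hlX, ?_⟩
  set E := F - X * y * MvPowerSeries.expand p hp.out.ne_zero F with hE
  have hE0 : proj V ⊥ E = 0 := by
    rw [hE, map_sub, mul_comm (X * y), proj_mul hl, hXF, mul_comm _ (X * y), ← hX, ← hlX, sub_self]
  have hbot (L : AddSubgroup M) : proj V ⊥ (proj V L E) = 0 := by
    rw [proj_proj bot_le, hE0]
  have hmem (c s : ℕ) (hsc : s + 1 ≤ c) :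
      proj V (level M p (s + 1)) E ∈ poleModule p V N F (s + 1) (s + 1) c := by
    induction s with
    | zero =>
      refine mem_poleModule_succ hN hF1 hsc ?_ (hbot _)
      rw [hE, map_sub]
      refine sub_mem (proj_mem_poleModule hN hf hfF ?_) ?_
      · exact self_mem_poleModule hN c
      · rw [← frob_one, proj_mul (suppOn_frob p V (0 + 1) F),
          (SuppOn.mono hl fun m hm => ?_).proj_eq]
        · exact mul_frob_mem_poleModule hN hl c
        · rw [AddSubgroup.mem_bot.mp hm]
          exact zero_mem _
    | succ s ih =>
      refine mem_poleModule_succ hN hF1 hsc ?_ (hbot _)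
      rw [← proj_proj (level_succ_le p (s + 1))]
      exact proj_mem_poleModule hN hf hfF (ih (by lia))
  intro s m hm
  obtain ⟨x, hx⟩ := exists_eq_mul_of_mem_poleModule le_rfl (hmem (s + 1) s le_rfl)
  have h := congrArg (MvPowerSeries.coeff m) hx
  rw [coeff_proj, if_pos hm, coeff_natCast_mul] at h
  exact ⟨_, h⟩

end Congruence

/-! ### Multinomial coefficients and logarithmic series -/

section Multinomial

theorem mul_multinomial {α : Type*} [DecidableEq α] {s : Finset α} {g g' : α → ℕ} {b : α}
    (hb : b ∈ s) (hgb : g b = g' b + 1) (hg : ∀ c ≠ b, g' c = g c) :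
    g b * Nat.multinomial s g = (∑ c ∈ s, g c) * Nat.multinomial s g' := by
  have h1 := Nat.multinomial_spec s g
  have h2 := Nat.multinomial_spec s g'
  have hsum : ∑ c ∈ s, g c = ∑ c ∈ s, g' c + 1 := by
    rw [← Finset.add_sum_erase s g hb, ← Finset.add_sum_erase s g' hb, hgb,
      Finset.sum_congr rfl fun c hc => hg c (Finset.ne_of_mem_erase hc)]
    ring
  have hprod : ∏ c ∈ s, (g c).factorial = g b * ∏ c ∈ s, (g' c).factorial := by
    rw [← Finset.mul_prod_erase s _ hb, ← Finset.mul_prod_erase s (fun c => (g' c).factorial) hb,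
      hgb, Nat.factorial_succ,
      Finset.prod_congr rfl fun c hc => by rw [← hg c (Finset.ne_of_mem_erase hc)]]
    ring
  have hpos : 0 < ∏ c ∈ s, (g' c).factorial :=
    Finset.prod_pos fun c _ => Nat.factorial_pos _
  apply Nat.eq_of_mul_eq_mul_left hpos
  calc (∏ c ∈ s, (g' c).factorial) * (g b * Nat.multinomial s g)
      = (∏ c ∈ s, (g c).factorial) * Nat.multinomial s g := by rw [hprod]; ring
    _ = (∑ c ∈ s, g c) * (∑ c ∈ s, g' c).factorial := by
        rw [h1, hsum, Nat.factorial_succ]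
    _ = _ := by rw [← h2]; ring

variable {ι : Type*}

/-- The series `-log (1 - w)`, for `w` the sum of the variables indexed by `J`; its part of degree
`n` is `w ^ n / n`. -/
def logSeries (J : Finset ι) : MvPowerSeries ι ℚ := fun m =>
  ((MvPowerSeries.coeff m ((∑ b ∈ J, MvPowerSeries.X b : MvPowerSeries ι ℤ) ^ m.degree) : ℤ) :
    ℚ) / m.degree

theorem coeff_logSeries (J : Finset ι) (m : ι →₀ ℕ) :
    MvPowerSeries.coeff m (logSeries J) =
      ((MvPowerSeries.coeff m
        ((∑ b ∈ J, MvPowerSeries.X b : MvPowerSeries ι ℤ) ^ m.degree) : ℤ) : ℚ) / m.degree := rfl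

open Classical in
theorem coeff_sum_X_pow (J : Finset ι) (m : ι →₀ ℕ) :
    MvPowerSeries.coeff m ((∑ b ∈ J, MvPowerSeries.X b : MvPowerSeries ι ℤ) ^ m.degree) =
      if m.support ⊆ J then (m.multinomial : ℤ) else 0 := by
  let a : ι →₀ ℤ := Finsupp.indicator J fun _ _ => 1
  have ha : (Finsupp.linearCombination ℤ MvPolynomial.X a : MvPolynomial ι ℤ) =
      ∑ b ∈ J, MvPolynomial.X b := by
    rw [Finsupp.linearCombination_apply, Finsupp.sum_of_support_subset (s := J) _
      (Finsupp.support_indicator_subset _ _) _ (by simp)]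
    refine Finset.sum_congr rfl fun b hb => ?_
    simp [Finsupp.indicator_of_mem hb]
  have hcoe : (∑ b ∈ J, MvPowerSeries.X b : MvPowerSeries ι ℤ) =
      ((∑ b ∈ J, MvPolynomial.X b : MvPolynomial ι ℤ) : MvPowerSeries ι ℤ) := by
    rw [← MvPolynomial.coeToMvPowerSeries.ringHom_apply, map_sum]
    simp
  rw [hcoe, ← MvPolynomial.coe_pow, MvPolynomial.coeff_coe, ← ha,
    MvPolynomial.coeff_linearCombination_X_pow, if_pos (by rfl)]
  split_ifs with h
  · rw [Finsupp.prod, Finset.prod_eq_one, mul_one]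
    intro b hb
    simp [a, Finsupp.indicator_of_mem (h hb)]
  · obtain ⟨b, hb, hbJ⟩ := Finset.not_subset.mp h
    rw [Finsupp.prod, Finset.prod_eq_zero hb, mul_zero]
    rw [Finsupp.indicator_of_notMem hbJ, zero_pow (Finsupp.mem_support_iff.mp hb)]

theorem constantCoeff_logSeries (J : Finset ι) :
    MvPowerSeries.constantCoeff (logSeries J) = 0 := by
  rw [← MvPowerSeries.coeff_zero_eq_constantCoeff_apply, coeff_logSeries]
  simp

/-- Applying the derivation `x_b ∂/∂x_b` to `-log (1 - w)` gives a series with integral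
coefficients. -/
theorem exists_intCast_eq_mul_coeff_logSeries (J : Finset ι) (m : ι →₀ ℕ) (b : ι) :
    ∃ n : ℤ, (m b : ℚ) * MvPowerSeries.coeff m (logSeries J) = n := by
  classical
  rw [coeff_logSeries, coeff_sum_X_pow]
  split_ifs with h
  · rcases Nat.eq_zero_or_pos (m b) with hb | hb
    · exact ⟨0, by simp [hb]⟩
    · have h1 := mul_multinomial (s := m.support) (g := m) (g' := Function.update m b (m b - 1))
        (b := b) (by simpa using hb.ne') (by simp; lia) fun c hc => by
          rw [Function.update_of_ne hc]
      have h0 : (m.degree : ℚ) ≠ 0 := by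
        rw [Nat.cast_ne_zero, Ne, Finsupp.degree_eq_zero_iff]
        rintro rfl
        simp at hb
      refine ⟨(Nat.multinomial m.support (Function.update m b (m b - 1)) : ℕ), ?_⟩
      rw [mul_div_assoc', div_eq_iff h0, mul_comm _ (m.degree : ℚ)]
      exact_mod_cast h1
  · exact ⟨0, by simp⟩

theorem coeff_logSeries_div_mem {p : ℕ} [hp : Fact p.Prime] (J : Finset ι) (m : ι →₀ ℕ) {b : ι}
    {s c : ℕ} (hb : m b = p ^ s * c) (hc : ¬ p ∣ c) :
    (p : ℚ) ^ s * MvPowerSeries.coeff m (logSeries J) ∈ pInt p := by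
  obtain ⟨n, hn⟩ := exists_intCast_eq_mul_coeff_logSeries J m b
  have hc0 : (c : ℚ) ≠ 0 := by
    rintro h
    rw [Nat.cast_eq_zero] at h
    simp [h] at hc
  have : (p : ℚ) ^ s * MvPowerSeries.coeff m (logSeries J) = n * (c : ℚ)⁻¹ := by
    rw [← hn, hb]
    push_cast
    field_simp
  rw [this]
  exact mul_mem (intCast_mem_pInt n) (inv_natCast_mem_pInt hc)

theorem pow_succ_dvd_pow_mul_sub {R : Type*} [CommRing R] {p : ℕ} {a b : R} (h : (p : R) ∣ a - b)
    (k n : ℕ) : (p ^ (k + 1) : R) ∣ a ^ (p ^ k * n) - b ^ (p ^ k * n) := by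
  rw [pow_mul, pow_mul]
  exact (dvd_sub_pow_of_dvd_sub h k).trans (sub_dvd_pow_sub_pow _ _ n)

/-- The logarithm of a series with integral coefficients satisfies the congruence of Dieudonné
and Dwork. -/
theorem exists_expand_logSeries (p : ℕ) [hp : Fact p.Prime] (J : Finset ι) :
    ∃ u ∈ pSeries ι p, MvPowerSeries.expand p hp.out.ne_zero (logSeries J) =
      (p : MvPowerSeries ι ℚ) * logSeries J + p * u := by
  classical
  have hp0 : (p : ℚ) ≠ 0 := by exact_mod_cast hp.out.ne_zero
  obtain ⟨u, hu, h⟩ := exists_mul_of_forall_coeff p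
    (MvPowerSeries.expand p hp.out.ne_zero (logSeries J) - (p : MvPowerSeries ι ℚ) * logSeries J)
    (fun x => x ∈ pInt p) fun m => by
      rw [map_sub, coeff_natCast_mul]
      rcases coeff_expand_cases hp.out.ne_zero (logSeries J) m with ⟨m', rfl⟩ | ⟨⟨b, hb⟩, h0⟩
      · rw [MvPowerSeries.coeff_expand_smul]
        rcases eq_or_ne m' 0 with rfl | hm'
        · exact ⟨0, zero_mem _, by simp [constantCoeff_logSeries]⟩
        -- For `n = p ^ k c` the powers `σ(w) ^ n` and `w ^ (p n)` agree modulo `p ^ (k + 1)`.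
        set w := (∑ b ∈ J, MvPowerSeries.X b : MvPowerSeries ι ℤ) with hw
        have hn : m'.degree ≠ 0 := by rwa [Ne, Finsupp.degree_eq_zero_iff]
        obtain ⟨k, c, hc, hkc⟩ := Nat.exists_eq_pow_mul_and_not_dvd hn p hp.out.ne_one
        have hc0 : (c : ℚ) ≠ 0 := by
          rintro h
          rw [Nat.cast_eq_zero] at h
          simp [h] at hc
        obtain ⟨x, hx⟩ := exists_expand_eq_pow_add (p := p) w
        obtain ⟨y, hy⟩ := pow_succ_dvd_pow_mul_sub (p := p)
          (a := MvPowerSeries.expand p hp.out.ne_zero w) (b := w ^ p) ⟨x, by rw [hx]; ring⟩ k c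
        rw [← hkc, ← map_pow, ← pow_mul, ← Nat.cast_pow] at hy
        have h1 := congrArg (MvPowerSeries.coeff (p • m')) hy
        rw [map_sub, MvPowerSeries.coeff_expand_smul, coeff_natCast_mul] at h1
        have h2 := congrArg (Int.cast (R := ℚ)) h1
        refine ⟨MvPowerSeries.coeff (p • m') y * (c : ℚ)⁻¹,
          mul_mem (intCast_mem_pInt _) (inv_natCast_mem_pInt hc), ?_⟩
        rw [coeff_logSeries, coeff_logSeries, ← hw]
        have hdeg : (p • m').degree = p * m'.degree := by simp
        rw [hdeg]
        have hn' : (m'.degree : ℚ) = p ^ k * c := by exact_mod_cast hkc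
        push_cast at h2 ⊢
        rw [hn']
        field_simp
        rw [h2]
        ring
      · rw [h0]
        have := coeff_logSeries_div_mem (p := p) (s := 0) J m (b := b) (by simp) hb
        rw [pow_zero, one_mul] at this
        exact ⟨_, neg_mem this, by ring⟩
  exact ⟨u, mem_pSeries.mpr hu, by rw [← h]; ring⟩

end Multinomial

/-! ### Generating functions of the multinomial coefficients -/

section Blocks

variable {p : ℕ} {q : Fin p → ℕ} {R : Type*} [CommRing R]

/-- The degree of a monomial in the variables of the `i`-th block. -/
def blockDegree (i : Fin p) (m : Idx q →₀ ℕ) : ℕ := ∑ j, m ⟨i, j⟩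

/-- The multinomial coefficient of the exponents in the `i`-th block. -/
def blockMultinomial (i : Fin p) (m : Idx q →₀ ℕ) : ℕ :=
  Nat.multinomial Finset.univ (fun j : Fin (q i) => m ⟨i, j⟩)

/-- The sum of the variables of the `i`-th block. -/
def blockSum (R : Type*) [CommRing R] (q : Fin p → ℕ) (i : Fin p) : MvPowerSeries (Idx q) R :=
  ∑ j, MvPowerSeries.X ⟨i, j⟩

theorem coeff_X_mul {ι : Type*} (b : ι) (x : MvPowerSeries ι R) (m : ι →₀ ℕ) :
    MvPowerSeries.coeff m (MvPowerSeries.X b * x) =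
      if m b = 0 then 0 else MvPowerSeries.coeff (m - Finsupp.single b 1) x := by
  rw [MvPowerSeries.X, MvPowerSeries.coeff_monomial_mul]
  simp only [Finsupp.single_le_iff, one_mul, Nat.one_le_iff_ne_zero, ite_not]

theorem coeff_blockSum_mul (i : Fin p) (x : MvPowerSeries (Idx q) R) (m : Idx q →₀ ℕ) :
    MvPowerSeries.coeff m (blockSum R q i * x) = ∑ j, if m ⟨i, j⟩ = 0 then 0 else
      MvPowerSeries.coeff (m - Finsupp.single ⟨i, j⟩ 1) x := by
  rw [blockSum, Finset.sum_mul, map_sum]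
  exact Finset.sum_congr rfl fun j _ => coeff_X_mul _ _ _

theorem sub_single_of_fst_ne {i i' : Fin p} (h : i' ≠ i) (m : Idx q →₀ ℕ) (j : Fin (q i))
    (j' : Fin (q i')) :
    (m - Finsupp.single ⟨i, j⟩ 1 : Idx q →₀ ℕ) ⟨i', j'⟩ = m ⟨i', j'⟩ := by
  classical
  rw [Finsupp.tsub_apply, Finsupp.single_apply, if_neg, Nat.sub_zero]
  intro h'
  exact h (congrArg Sigma.fst h').symm

theorem sub_single_of_ne {i : Fin p} {j j' : Fin (q i)} (h : j' ≠ j) (m : Idx q →₀ ℕ) :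
    (m - Finsupp.single ⟨i, j⟩ 1 : Idx q →₀ ℕ) ⟨i, j'⟩ = m ⟨i, j'⟩ := by
  classical
  rw [Finsupp.tsub_apply, Finsupp.single_apply, if_neg, Nat.sub_zero]
  intro h'
  simp only [Sigma.mk.injEq, heq_eq_eq, true_and] at h'
  exact h h'.symm

theorem sub_single_self (b : Idx q) {m : Idx q →₀ ℕ} (h : m b ≠ 0) :
    m b = (m - Finsupp.single b 1 : Idx q →₀ ℕ) b + 1 := by
  rw [Finsupp.tsub_apply, Finsupp.single_eq_same]
  lia

theorem blockDegree_sub_single {i : Fin p} {j : Fin (q i)} {m : Idx q →₀ ℕ}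
    (h : m ⟨i, j⟩ ≠ 0) :
    blockDegree i m = blockDegree i (m - Finsupp.single (⟨i, j⟩ : Idx q) 1) + 1 := by
  classical
  have h1 := Finset.add_sum_erase Finset.univ (fun j' => m ⟨i, j'⟩) (Finset.mem_univ j)
  have h2 := Finset.add_sum_erase Finset.univ
    (fun j' => (m - Finsupp.single ⟨i, j⟩ 1 : Idx q →₀ ℕ) ⟨i, j'⟩) (Finset.mem_univ j)
  rw [Finset.sum_congr rfl fun c hc => sub_single_of_ne (Finset.ne_of_mem_erase hc) m] at h2
  rw [blockDegree, blockDegree, ← h1, ← h2, sub_single_self _ h, add_right_comm]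

theorem blockDegree_sub_single_of_ne {i i' : Fin p} (h : i' ≠ i) (j : Fin (q i))
    (m : Idx q →₀ ℕ) :
    blockDegree i' (m - Finsupp.single (⟨i, j⟩ : Idx q) 1) = blockDegree i' m :=
  Finset.sum_congr rfl fun j' _ => sub_single_of_fst_ne h m j j'

theorem blockMultinomial_sub_single_of_ne {i i' : Fin p} (h : i' ≠ i) (j : Fin (q i))
    (m : Idx q →₀ ℕ) :
    blockMultinomial i' (m - Finsupp.single (⟨i, j⟩ : Idx q) 1) = blockMultinomial i' m :=
  Nat.multinomial_congr fun j' _ => sub_single_of_fst_ne h m j j'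

theorem mul_blockMultinomial {i : Fin p} {j : Fin (q i)} {m : Idx q →₀ ℕ}
    (h : m ⟨i, j⟩ ≠ 0) : m ⟨i, j⟩ * blockMultinomial i m =
      blockDegree i m * blockMultinomial i (m - Finsupp.single (⟨i, j⟩ : Idx q) 1) :=
  mul_multinomial (g := fun j => m ⟨i, j⟩) (Finset.mem_univ j) (sub_single_self _ h)
    fun _ hc => sub_single_of_ne hc m

theorem blockMultinomial_eq_one {i : Fin p} {m : Idx q →₀ ℕ} (h : blockDegree i m = 0) :
    blockMultinomial i m = 1 := by
  rw [blockDegree, Finset.sum_eq_zero_iff] at h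
  rw [blockMultinomial, Nat.multinomial_congr (g := fun _ => 0) fun j hj => h j hj]
  simp [Nat.multinomial]

theorem sum_blockMultinomial {i : Fin p} {m : Idx q →₀ ℕ} (h : blockDegree i m ≠ 0) :
    (∑ j, if m ⟨i, j⟩ = 0 then 0 else
      blockMultinomial i (m - Finsupp.single (⟨i, j⟩ : Idx q) 1)) = blockMultinomial i m := by
  apply Nat.eq_of_mul_eq_mul_left (Nat.pos_of_ne_zero h)
  rw [Finset.mul_sum]
  conv_rhs => rw [blockDegree, Finset.sum_mul]
  refine Finset.sum_congr rfl fun j _ => ?_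
  split_ifs with hj
  · rw [hj, mul_zero, zero_mul]
  · exact (mul_blockMultinomial hj).symm

/-- The polynomial `∏ᵢ (1 - ∑ⱼ z_{ij})`. -/
def blockPoly (R : Type*) [CommRing R] (q : Fin p → ℕ) : MvPowerSeries (Idx q) R :=
  ∏ i, (1 - blockSum R q i)

/-- The series with coefficients `κ(m)` times the multinomial coefficients of the blocks outside
`S`, restricted to the monomials that do not involve the blocks in `S`. -/
def partialSeries (κ : (Idx q →₀ ℕ) → R) (S : Finset (Fin p)) : MvPowerSeries (Idx q) R :=
  fun m => if ∀ i ∈ S, blockDegree i m = 0 then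
    κ m * ((∏ i ∈ Sᶜ, blockMultinomial i m : ℕ) : R) else 0

theorem coeff_partialSeries (κ : (Idx q →₀ ℕ) → R) (S : Finset (Fin p)) (m : Idx q →₀ ℕ) :
    MvPowerSeries.coeff m (partialSeries κ S) = if ∀ i ∈ S, blockDegree i m = 0 then
      κ m * ((∏ i ∈ Sᶜ, blockMultinomial i m : ℕ) : R) else 0 := rfl

theorem partialSeries_insert {κ : (Idx q →₀ ℕ) → R} {S : Finset (Fin p)} {i : Fin p}
    (hi : i ∉ S)
    (hκ : ∀ m j, m ⟨i, j⟩ ≠ 0 → κ (m - Finsupp.single ⟨i, j⟩ 1) = κ m) :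
    partialSeries κ (insert i S) = (1 - blockSum R q i) * partialSeries κ S := by
  ext m
  have hS (j : Fin (q i)) : (∀ i' ∈ S,
      blockDegree i' (m - Finsupp.single (⟨i, j⟩ : Idx q) 1) = 0) ↔
        ∀ i' ∈ S, blockDegree i' m = 0 :=
    forall₂_congr fun i' hi' => by
      rw [blockDegree_sub_single_of_ne (ne_of_mem_of_not_mem hi' hi)]
  have hprod (m : Idx q →₀ ℕ) : ∏ i' ∈ Sᶜ, blockMultinomial i' m =
      blockMultinomial i m * ∏ i' ∈ (insert i S)ᶜ, blockMultinomial i' m := by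
    rw [Finset.compl_insert, Finset.mul_prod_erase _ (fun i' => blockMultinomial i' m)
      (Finset.mem_compl.mpr hi)]
  have hprod' (j : Fin (q i)) : ∏ i' ∈ (insert i S)ᶜ,
      blockMultinomial i' (m - Finsupp.single (⟨i, j⟩ : Idx q) 1) =
        ∏ i' ∈ (insert i S)ᶜ, blockMultinomial i' m :=
    Finset.prod_congr rfl fun i' hi' => blockMultinomial_sub_single_of_ne
      (fun h => Finset.mem_compl.mp hi' (Finset.mem_insert.mpr (Or.inl h))) j m
  rw [sub_mul, one_mul, map_sub, coeff_blockSum_mul, coeff_partialSeries, coeff_partialSeries]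
  simp only [coeff_partialSeries, hS, Finset.forall_mem_insert]
  by_cases hm : ∀ i' ∈ S, blockDegree i' m = 0
  · simp only [eq_true hm, and_true, if_true]
    simp only [hprod, hprod']
    by_cases hd : blockDegree i m = 0
    · have h0 (j : Fin (q i)) : m ⟨i, j⟩ = 0 := by
        rw [blockDegree, Finset.sum_eq_zero_iff] at hd
        exact hd j (Finset.mem_univ j)
      simp [hd, h0, blockMultinomial_eq_one hd]
    · rw [if_neg hd]
      symm
      rw [sub_eq_zero]
      conv_lhs => rw [← sum_blockMultinomial hd]
      rw [Nat.cast_mul, Nat.cast_sum, Finset.sum_mul, Finset.mul_sum]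
      refine Finset.sum_congr rfl fun j _ => ?_
      split_ifs with hj
      · simp
      · rw [hκ m j hj, Nat.cast_mul]
  · simp only [eq_false hm, and_false, if_false, ite_self, Finset.sum_const_zero,
      sub_zero]

theorem partialSeries_eq_prod_mul {κ : (Idx q →₀ ℕ) → R} (S : Finset (Fin p))
    (hκ : ∀ i ∈ S, ∀ m j, m ⟨i, j⟩ ≠ 0 → κ (m - Finsupp.single ⟨i, j⟩ 1) = κ m) :
    partialSeries κ S = (∏ i ∈ S, (1 - blockSum R q i)) * partialSeries κ ∅ := by
  classical
  induction S using Finset.induction_on with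
  | empty => simp
  | insert i S hi ih =>
    rw [partialSeries_insert hi (hκ i (Finset.mem_insert_self _ _)),
      ih fun i' hi' => hκ i' (Finset.mem_insert_of_mem hi'), Finset.prod_insert hi, mul_assoc]

/-- The generating function of the products of multinomial coefficients. -/
def combSeries (R : Type*) [CommRing R] (q : Fin p → ℕ) : MvPowerSeries (Idx q) R :=
  fun m => (combProd m : R)

theorem coeff_combSeries (m : Idx q →₀ ℕ) :
    MvPowerSeries.coeff m (combSeries R q) = (combProd m : R) := rfl

theorem combProd_eq (m : Idx q →₀ ℕ) : combProd m = ∏ i, blockMultinomial i m := rfl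

theorem eq_zero_iff_blockDegree {m : Idx q →₀ ℕ} : m = 0 ↔ ∀ i, blockDegree i m = 0 := by
  constructor
  · rintro rfl i
    simp [blockDegree]
  · intro h
    ext ⟨i, j⟩
    have := h i
    rw [blockDegree, Finset.sum_eq_zero_iff] at this
    exact this j (Finset.mem_univ j)

/-- `∑ c(k) z^k = ∏ᵢ (1 - ∑ⱼ z_{ij})⁻¹`. -/
theorem blockPoly_mul_combSeries : blockPoly R q * combSeries R q = 1 := by
  classical
  have h1 : combSeries R q = partialSeries (fun _ => (1 : R)) ∅ := by
    ext m
    rw [coeff_partialSeries, coeff_combSeries, combProd_eq]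
    simp
  rw [h1, blockPoly, ← partialSeries_eq_prod_mul _ fun _ _ _ _ _ => rfl]
  ext m
  rw [coeff_partialSeries, MvPowerSeries.coeff_one]
  simp [eq_zero_iff_blockDegree]

theorem constantCoeff_combSeries : MvPowerSeries.constantCoeff (combSeries R q) = 1 := by
  rw [← MvPowerSeries.coeff_zero_eq_constantCoeff_apply, coeff_combSeries]
  simp [combProd, Nat.multinomial]

/-- The weight `H(∑_l k_{il}) - H(k_{ij})`. -/
def harmonicWeight (a : Idx q) (m : Idx q →₀ ℕ) : ℚ :=
  harmonic (blockDegree a.1 m) - harmonic (m a)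

/-- The series `∑ c(k) (H(∑_l k_{il}) - H(k_{ij})) z^k` over all exponents `k`. -/
def harmonicSeries (a : Idx q) : MvPowerSeries (Idx q) ℚ :=
  fun m => combProd m * harmonicWeight a m

theorem coeff_harmonicSeries (a : Idx q) (m : Idx q →₀ ℕ) :
    MvPowerSeries.coeff m (harmonicSeries a) = combProd m * harmonicWeight a m := rfl

/-- The variables of the block of `a` other than `a` itself. -/
def otherVars (a : Idx q) : Finset (Idx q) :=
  {b | b.1 = a.1 ∧ b ≠ a}

theorem support_subset_otherVars {a : Idx q} {m : Idx q →₀ ℕ} :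
    m.support ⊆ otherVars a ↔ m a = 0 ∧ ∀ i ∈ Finset.univ.erase a.1, blockDegree i m = 0 := by
  classical
  constructor
  · intro h
    refine ⟨?_, fun i hi => Finset.sum_eq_zero fun j _ => ?_⟩
    · by_contra h0
      have := h (Finsupp.mem_support_iff.mpr h0)
      simp [otherVars] at this
    · by_contra h0
      have := h (Finsupp.mem_support_iff.mpr h0)
      simp only [otherVars, Finset.mem_filter] at this
      exact Finset.ne_of_mem_erase hi this.2.1
  · rintro ⟨h1, h2⟩ ⟨i, j⟩ hb
    simp only [otherVars, Finset.mem_filter, Finset.mem_univ, true_and]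
    constructor
    · by_contra hi
      have := h2 i (Finset.mem_erase.mpr ⟨hi, Finset.mem_univ _⟩)
      rw [blockDegree, Finset.sum_eq_zero_iff] at this
      exact Finsupp.mem_support_iff.mp hb (this j (Finset.mem_univ j))
    · intro hba
      rw [Finsupp.mem_support_iff, hba] at hb
      exact hb h1

theorem degree_eq_sum_blockDegree (m : Idx q →₀ ℕ) : m.degree = ∑ i, blockDegree i m := by
  rw [Finsupp.degree_eq_sum, Fintype.sum_sigma]
  rfl

theorem multinomial_eq_blockMultinomial {i : Fin p} {m : Idx q →₀ ℕ}
    (h : ∀ i' ∈ Finset.univ.erase i, blockDegree i' m = 0) :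
    m.multinomial = blockMultinomial i m := by
  classical
  have hsub : m.support ⊆ Finset.univ.map (Function.Embedding.sigmaMk i) := by
    rintro ⟨i', j⟩ hb
    have hi : i' = i := by
      by_contra hi
      have := h i' (Finset.mem_erase.mpr ⟨hi, Finset.mem_univ _⟩)
      rw [blockDegree, Finset.sum_eq_zero_iff] at this
      exact Finsupp.mem_support_iff.mp hb (this j (Finset.mem_univ j))
    rw [Finset.mem_map]
    exact ⟨hi ▸ j, Finset.mem_univ _, by cases hi; rfl⟩
  rw [Finsupp.multinomial_eq_of_support_subset hsub, blockMultinomial, Nat.multinomial,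
    Nat.multinomial, Finset.sum_map, Finset.prod_map]
  rfl

theorem harmonicWeight_sub_single {i : Fin p} {j₀ j : Fin (q i)} {m : Idx q →₀ ℕ}
    (hj : m ⟨i, j⟩ ≠ 0) :
    harmonicWeight ⟨i, j₀⟩ (m - Finsupp.single (⟨i, j⟩ : Idx q) 1) =
      harmonicWeight ⟨i, j₀⟩ m - (blockDegree i m : ℚ)⁻¹ +
        if j = j₀ then (m ⟨i, j₀⟩ : ℚ)⁻¹ else 0 := by
  have h1 := blockDegree_sub_single hj
  have h2 : harmonic (blockDegree i m) =
      harmonic (blockDegree i (m - Finsupp.single (⟨i, j⟩ : Idx q) 1)) +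
        (blockDegree i m : ℚ)⁻¹ := by
    conv_lhs => rw [h1, harmonic_succ, ← h1]
  rw [harmonicWeight, harmonicWeight, h2]
  split_ifs with h
  · subst h
    have h3 := sub_single_self (⟨i, j⟩ : Idx q) hj
    have h4 : harmonic (m ⟨i, j⟩) =
        harmonic ((m - Finsupp.single ⟨i, j⟩ 1 : Idx q →₀ ℕ) ⟨i, j⟩) + (m ⟨i, j⟩ : ℚ)⁻¹ := by
      conv_lhs => rw [h3, harmonic_succ, ← h3]
    rw [h4]
    ring
  · rw [sub_single_of_ne (fun h' => h h'.symm)]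
    ring

/-- Multiplied by `1 - ∑ⱼ z_{ij}`, the series with coefficients `c(k) (H(∑_l k_{il}) - H(k_{ij}))`
in the variables of one block becomes a logarithm. -/
theorem blockSum_mul_partialSeries (a : Idx q) :
    (1 - blockSum ℚ q a.1) * partialSeries (harmonicWeight a) (Finset.univ.erase a.1) =
      logSeries (otherVars a) := by
  classical
  ext m
  have hS (j : Fin (q a.1)) : (∀ i' ∈ Finset.univ.erase a.1,
      blockDegree i' (m - Finsupp.single (⟨a.1, j⟩ : Idx q) 1) = 0) ↔
      ∀ i' ∈ Finset.univ.erase a.1, blockDegree i' m = 0 :=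
    forall₂_congr fun i' hi' => by
      rw [blockDegree_sub_single_of_ne (Finset.ne_of_mem_erase hi')]
  have hcompl : (Finset.univ.erase a.1)ᶜ = {a.1} := by
    ext i
    simp
  rw [sub_mul, one_mul, map_sub, coeff_blockSum_mul, coeff_logSeries, coeff_sum_X_pow,
    coeff_partialSeries]
  simp only [coeff_partialSeries, hS, support_subset_otherVars, hcompl, Finset.prod_singleton]
  by_cases hm : ∀ i' ∈ Finset.univ.erase a.1, blockDegree i' m = 0
  · have hdeg : m.degree = blockDegree a.1 m := by
      rw [degree_eq_sum_blockDegree, ← Finset.add_sum_erase _ _ (Finset.mem_univ a.1),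
        Finset.sum_eq_zero hm, add_zero]
    rw [if_pos hm]
    simp only [eq_true hm, and_true, if_true]
    rw [multinomial_eq_blockMultinomial hm, hdeg]
    by_cases hd : blockDegree a.1 m = 0
    · have h0 (j : Fin (q a.1)) : m ⟨a.1, j⟩ = 0 := by
        rw [blockDegree, Finset.sum_eq_zero_iff] at hd
        exact hd j (Finset.mem_univ j)
      have ha : m a = 0 := h0 a.2
      simp [hd, h0, harmonicWeight]
    · have hd' : (blockDegree a.1 m : ℚ) ≠ 0 := Nat.cast_ne_zero.mpr hd
      have hsum := congrArg (Nat.cast (R := ℚ)) (sum_blockMultinomial hd)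
      rw [Nat.cast_sum] at hsum
      have hterm (j : Fin (q a.1)) : (if m ⟨a.1, j⟩ = 0 then (0 : ℚ) else
          harmonicWeight a (m - Finsupp.single (⟨a.1, j⟩ : Idx q) 1) *
            blockMultinomial a.1 (m - Finsupp.single (⟨a.1, j⟩ : Idx q) 1)) =
          (harmonicWeight a m - (blockDegree a.1 m : ℚ)⁻¹) *
            ((if m ⟨a.1, j⟩ = 0 then 0 else
              blockMultinomial a.1 (m - Finsupp.single (⟨a.1, j⟩ : Idx q) 1) : ℕ) : ℚ) +
          if j = a.2 then (if m a = 0 then 0 else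
            (blockMultinomial a.1 m : ℚ) / blockDegree a.1 m) else 0 := by
        by_cases hj : m ⟨a.1, j⟩ = 0
        · by_cases hj' : j = a.2
          · have ha : m a = 0 := by rwa [hj'] at hj
            simp [hj, ha]
          · simp [hj, hj']
        · rw [if_neg hj, if_neg hj, harmonicWeight_sub_single (j₀ := a.2) hj]
          by_cases hj' : j = a.2
          · subst hj'
            have ha : m a ≠ 0 := hj
            have ha' : (m a : ℚ) ≠ 0 := Nat.cast_ne_zero.mpr ha
            have h1 := congrArg (Nat.cast (R := ℚ)) (mul_blockMultinomial hj)
            rw [if_pos rfl, if_pos rfl, if_neg ha, add_mul]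
            push_cast at h1
            simp only [Sigma.eta] at h1 ⊢
            congr 1
            field_simp
            linarith
          · rw [if_neg hj', if_neg hj']
            ring
      rw [Finset.sum_congr rfl fun j _ => hterm j, Finset.sum_add_distrib, ← Finset.mul_sum, hsum,
        Finset.sum_ite_eq' Finset.univ a.2, if_pos (Finset.mem_univ _)]
      split_ifs
      · push_cast
        field_simp
        ring
      · push_cast
        field_simp
        ring
  · simp only [eq_false hm, and_false, if_false, ite_self, Finset.sum_const_zero,
      sub_zero, Int.cast_zero, zero_div]

/-- `∑ c(k) (H(∑_l k_{il}) - H(k_{ij})) z^k` is the product of `∑ c(k) z^k` and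
`-log (1 - ∑_{l ≠ j} z_{il})`. -/
theorem harmonicSeries_eq (a : Idx q) :
    harmonicSeries a = logSeries (otherVars a) * combSeries ℚ q := by
  classical
  have h1 : harmonicSeries a = partialSeries (harmonicWeight a) ∅ := by
    ext m
    rw [coeff_partialSeries, coeff_harmonicSeries, combProd_eq]
    simp [mul_comm]
  have h2 : blockPoly ℚ q * harmonicSeries a = logSeries (otherVars a) := by
    rw [← blockSum_mul_partialSeries, partialSeries_eq_prod_mul (Finset.univ.erase a.1), ← h1,
      ← mul_assoc, Finset.mul_prod_erase Finset.univ (fun i => 1 - blockSum ℚ q i)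
        (Finset.mem_univ a.1), blockPoly]
    intro i hi m j _
    rw [harmonicWeight, harmonicWeight,
      blockDegree_sub_single_of_ne (Finset.ne_of_mem_erase hi).symm]
    congr 2
    exact sub_single_of_fst_ne (Finset.ne_of_mem_erase hi).symm m j a.2
  calc harmonicSeries a = (blockPoly ℚ q * combSeries ℚ q) * harmonicSeries a := by
        rw [blockPoly_mul_combSeries, one_mul]
    _ = (blockPoly ℚ q * harmonicSeries a) * combSeries ℚ q := by ring
    _ = _ := by rw [h2]

end Blocks

/-! ### The gauge of the Minkowski sum -/

section Gauge

open Topology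

variable {d p : ℕ} {q : Fin p → ℕ}

/-- The homomorphism sending an exponent `k` to `∑ k_{ij} v_{ij}`. -/
def degHom (v : Idx q → Fin d → ℤ) : (Idx q →₀ ℕ) →+ (Fin d → ℤ) where
  toFun m := V v (expo m)
  map_zero' := by rw [expo_zero, map_zero]
  map_add' m n := by rw [expo_add, map_add]

theorem expo_mem_K₀_iff {v : Idx q → Fin d → ℤ} {m : Idx q →₀ ℕ} :
    expo m ∈ K₀ v ↔ degHom v m ∈ (⊥ : AddSubgroup (Fin d → ℤ)) :=
  ⟨fun h => LinearMap.mem_ker.mp h.1,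
    fun h => ⟨LinearMap.mem_ker.mpr h, fun _ => Int.natCast_nonneg _⟩⟩

theorem degHom_single (v : Idx q → Fin d → ℤ) (b : Idx q) :
    degHom v (Finsupp.single b 1) = v b := by
  classical
  have : expo (Finsupp.single b 1) = Pi.single b 1 := by
    funext c
    by_cases h : c = b
    · subst h
      simp [expo]
    · simp [expo, h]
  change V v _ = _
  rw [this, V, Fintype.linearCombination_apply_single, one_smul]

theorem toReal_add (x y : Fin d → ℤ) : toReal (x + y) = toReal x + toReal y := by
  funext l
  simp [toReal]

theorem toReal_nsmul (n : ℕ) (x : Fin d → ℤ) : toReal (n • x) = (n : ℝ) • toReal x := by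
  funext l
  simp [toReal]

theorem toReal_zero : toReal (0 : Fin d → ℤ) = 0 := by
  funext l
  simp [toReal]

theorem convex_Δ (v : Idx q → Fin d → ℤ) : Convex ℝ (Δ v) := by
  classical
  unfold Δ
  refine Finset.sum_induction _ (fun s => Convex ℝ s) (fun _ _ hs ht => hs.add ht)
    (convex_singleton 0) fun i _ => convex_convexHull ℝ _

theorem isFanoGauge_gauge {v : Idx q → Fin d → ℤ} (hv : IsFano v) :
    IsFanoGauge fun x => gauge (Δ v) (toReal x) := by
  have h0 : (0 : Fin d → ℝ) ∈ interior (Δ v) := by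
    rw [← toReal_zero]
    exact (hv 0).mpr rfl
  have hnhds : Δ v ∈ 𝓝 (0 : Fin d → ℝ) := mem_interior_iff_mem_nhds.mp h0
  refine ⟨fun x y => ?_, fun n x => ?_, fun x hx => ?_⟩
  · rw [toReal_add]
    exact gauge_add_le (convex_Δ v) (absorbent_nhds_zero hnhds) _ _
  · rw [toReal_nsmul, gauge_smul_of_nonneg (Nat.cast_nonneg n), smul_eq_mul]
  · exact (hv x).mp ((gauge_lt_one_iff_mem_interior (convex_Δ v) hnhds).mp hx)

/-- The Newton polytope of `∏ᵢ (1 - ∑ⱼ z_{ij} x^{v_{ij}})` is contained in `Δ`. -/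
theorem suppOn_blockPoly (v : Idx q → Fin d → ℤ) :
    SuppOn (blockPoly ℤ q) (fun m => gauge (Δ v) (toReal (degHom v m)) ≤ 1) := by
  classical
  suffices h : SuppOn (blockPoly ℤ q) (fun m => toReal (degHom v m) ∈ Δ v) from
    h.mono fun m hm => gauge_le_one_of_mem hm
  unfold blockPoly Δ
  induction (Finset.univ : Finset (Fin p)) using Finset.induction_on with
  | empty =>
    rw [Finset.prod_empty, Finset.sum_empty]
    exact suppOn_one (by rw [map_zero, toReal_zero]; exact Set.zero_mem_zero)
  | insert i S hi ih =>
    rw [Finset.prod_insert hi, Finset.sum_insert hi]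
    have h1 : SuppOn (1 - blockSum ℤ q i) (fun m => toReal (degHom v m) ∈ Δpart v i) := by
      intro m hm
      apply subset_convexHull
      by_cases hm0 : m = 0
      · left
        rw [hm0, map_zero, toReal_zero]
      · right
        rw [map_sub, MvPowerSeries.coeff_one, if_neg hm0, blockSum, map_sum, zero_sub, neg_ne_zero]
          at hm
        obtain ⟨j, -, hj⟩ := Finset.exists_ne_zero_of_sum_ne_zero hm
        rw [MvPowerSeries.coeff_X] at hj
        refine ⟨j, ?_⟩
        have hmj : m = Finsupp.single ⟨i, j⟩ 1 := by
          by_contra h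
          exact hj (if_neg h)
        rw [hmj, degHom_single]
    refine h1.mul ih fun a b ha hb => ?_
    rw [map_add, toReal_add]
    exact Set.add_mem_add ha hb

end Gauge

/-! ### Integrality of the mirror map -/

section Integrality

variable {ι M : Type*} [AddCommGroup M] {V : (ι →₀ ℕ) →+ M}

theorem map_proj {R S : Type*} [CommRing R] [CommRing S] (g : R →+* S) (L : AddSubgroup M)
    (x : MvPowerSeries ι R) :
    MvPowerSeries.map g (proj V L x) = proj V L (MvPowerSeries.map g x) := by
  ext m
  rw [MvPowerSeries.coeff_map, coeff_proj, coeff_proj, MvPowerSeries.coeff_map]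
  split_ifs <;> simp

theorem proj_mem_pSeries {p : ℕ} [Fact p.Prime] {L : AddSubgroup M} {x : MvPowerSeries ι ℚ}
    (hx : x ∈ pSeries ι p) : proj V L x ∈ pSeries ι p := by
  rw [mem_pSeries] at hx ⊢
  intro m
  rw [coeff_proj]
  split_ifs
  · exact hx m
  · exact zero_mem _

theorem exists_eq_pow_nsmul {p : ℕ} (hp : p.Prime) (m : ι →₀ ℕ) (hm : m ≠ 0) :
    ∃ (s : ℕ) (m' : ι →₀ ℕ) (b : ι), m = p ^ s • m' ∧ ¬ p ∣ m' b := by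
  induction hn : m.degree using Nat.strong_induction_on generalizing m with
  | _ n ih =>
    by_cases h : ∀ b, p ∣ m b
    · let m₁ : ι →₀ ℕ := m.mapRange (fun a => a / p) (Nat.zero_div p)
      have hm₁ : m = p • m₁ := by
        ext b
        simp [m₁, Nat.mul_div_cancel' (h b)]
      have hm₁0 : m₁ ≠ 0 := by
        rintro h0
        rw [h0, smul_zero] at hm₁
        exact hm hm₁
      have hlt : m₁.degree < n := by
        have h1 : n = p * m₁.degree := by rw [← hn, hm₁]; simp
        have h2 : 0 < m₁.degree :=
          Nat.pos_of_ne_zero fun h => hm₁0 ((Finsupp.degree_eq_zero_iff _).mp h)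
        have := hp.two_le
        nlinarith
      obtain ⟨s, m', b, h1, h2⟩ := ih _ hlt m₁ hm₁0 rfl
      exact ⟨s + 1, m', b, by rw [pow_succ', mul_smul, ← h1, ← hm₁], h2⟩
    · push Not at h
      obtain ⟨b, hb⟩ := h
      exact ⟨0, m, b, by simp, hb⟩

/-- The denominators of a logarithmic series are compensated by a series whose coefficients in
degrees divisible by `p ^ s` are divisible by `p ^ s`. -/
theorem exists_proj_expand_logSeries_mul (p : ℕ) [hp : Fact p.Prime] (J : Finset ι)
    {E : MvPowerSeries ι ℤ} (hE : ∀ s m, V m ∈ level M p (s + 1) →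
      ((p ^ (s + 1) : ℕ) : ℤ) ∣ MvPowerSeries.coeff m E) :
    ∃ z ∈ pSeries ι p, proj V ⊥ (MvPowerSeries.expand p hp.out.ne_zero (logSeries J) *
      MvPowerSeries.map (Int.castRingHom ℚ) E) = p * z := by
  classical
  have hsub : ∀ m, V m = 0 → MvPowerSeries.coeff m
      (MvPowerSeries.expand p hp.out.ne_zero (logSeries J) *
        MvPowerSeries.map (Int.castRingHom ℚ) E) ∈
      (pInt p).toAddSubgroup.map (AddMonoidHom.mulLeft (p : ℚ)) := by
    intro m hm
    rw [MvPowerSeries.coeff_mul]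
    refine sum_mem fun ⟨a, b⟩ hab => ?_
    rw [Finset.HasAntidiagonal.mem_antidiagonal] at hab
    simp only at hab ⊢
    rcases coeff_expand_cases hp.out.ne_zero (logSeries J) a with ⟨a, rfl⟩ | ⟨-, h0⟩
    · rw [MvPowerSeries.coeff_expand_smul, MvPowerSeries.coeff_map]
      rcases eq_or_ne a 0 with rfl | ha
      · rw [MvPowerSeries.coeff_zero_eq_constantCoeff_apply, constantCoeff_logSeries, zero_mul]
        exact zero_mem _
      · obtain ⟨s, a', c, rfl, hc⟩ := exists_eq_pow_nsmul hp.out a ha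
        have hVb : V b ∈ level M p (s + 1) := by
          refine ⟨-V a', ?_⟩
          rw [← hab, map_add, map_nsmul, map_nsmul] at hm
          rw [nsmulAddMonoidHom_apply, smul_neg, pow_succ', mul_smul]
          exact neg_eq_of_add_eq_zero_right hm
        obtain ⟨x, hx⟩ := hE s b hVb
        refine ⟨(p : ℚ) ^ s * MvPowerSeries.coeff (p ^ s • a') (logSeries J) * x,
          (pInt p).mul_mem (coeff_logSeries_div_mem J _ (b := c) (by simp) hc)
            (intCast_mem_pInt x), ?_⟩
        rw [hx, AddMonoidHom.coe_mulLeft, eq_intCast]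
        push_cast
        ring
    · rw [h0, zero_mul]
      exact zero_mem _
  obtain ⟨z, hz, h⟩ := exists_mul_of_forall_coeff p
    (proj V ⊥ (MvPowerSeries.expand p hp.out.ne_zero (logSeries J) *
      MvPowerSeries.map (Int.castRingHom ℚ) E)) (fun x => x ∈ pInt p) fun m => by
        rw [coeff_proj]
        split_ifs with hm
        · obtain ⟨x, hx, h⟩ := hsub m (AddSubgroup.mem_bot.mp hm)
          exact ⟨x, hx, h.symm⟩
        · exact ⟨0, zero_mem _, by simp⟩
  exact ⟨z, mem_pSeries.mpr hz, h⟩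

/-- Let `F` be the inverse of a Laurent polynomial whose Newton polytope has the origin as its
only interior lattice point, and let `L` be the logarithm of a linear form. The exponential of
the quotient of the degree zero parts of `L F` and `F` is `p`-integral. -/
theorem exp_quotient_mem_pSeries (p : ℕ) [hp : Fact p.Prime] {N : M → ℝ} (hN : IsFanoGauge N)
    {f F : MvPowerSeries ι ℤ} (hf : SuppOn f (fun m => N (V m) ≤ 1)) (hfF : f * F = 1)
    (hF1 : MvPowerSeries.constantCoeff F = 1) (J : Finset ι) :
    (PowerSeries.exp ℚ).subst
      (proj V ⊥ (logSeries J * MvPowerSeries.map (Int.castRingHom ℚ) F) *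
        (proj V ⊥ (MvPowerSeries.map (Int.castRingHom ℚ) F))⁻¹) ∈ pSeries ι p := by
  obtain ⟨l, hl, hlX, hE⟩ := dwork_congruence p hN hf hfF hF1
  obtain ⟨u, hu, hlog⟩ := exists_expand_logSeries p J
  obtain ⟨z, hz, hzE⟩ := exists_proj_expand_logSeries_mul p J hE
  have hMp : ∀ x : M, p • x = 0 → x = 0 := fun x => hN.eq_zero_of_nsmul hp.out.ne_zero x
  obtain ⟨y, hy⟩ := exists_mul_eq_one (x := proj V ⊥ F) (by rw [constantCoeff_proj, hF1])
  have hyQ := congrArg (MvPowerSeries.map (Int.castRingHom ℚ)) hy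
  have hlXQ := congrArg (MvPowerSeries.map (Int.castRingHom ℚ)) hlX
  rw [map_mul, map_proj, map_one] at hyQ
  rw [map_mul, MvPowerSeries.map_expand, map_proj] at hlXQ
  rw [map_sub (MvPowerSeries.map (Int.castRingHom ℚ)), map_mul (MvPowerSeries.map _),
    MvPowerSeries.map_expand] at hzE
  have hlQ : SuppOn (MvPowerSeries.map (Int.castRingHom ℚ) l)
      (fun m => V m ∈ (⊥ : AddSubgroup M)) := fun m hm => hl m fun h => hm (by
    rw [MvPowerSeries.coeff_map, h, map_zero])
  have hFint := map_intCast_mem_pSeries (p := p) F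
  have hyint := map_intCast_mem_pSeries (p := p) y
  set FQ := MvPowerSeries.map (Int.castRingHom ℚ) F
  set lQ := MvPowerSeries.map (Int.castRingHom ℚ) l
  set yQ := MvPowerSeries.map (Int.castRingHom ℚ) y
  set L := logSeries J with hL
  have hX1 : MvPowerSeries.constantCoeff (proj V ⊥ FQ) ≠ 0 := by
    intro h
    have := congrArg MvPowerSeries.constantCoeff hyQ
    rw [map_mul, h, mul_zero, map_one] at this
    exact zero_ne_one this
  have hinv : (proj V ⊥ FQ)⁻¹ = yQ :=
    ((MvPowerSeries.eq_inv_iff_mul_eq_one hX1).mpr hyQ).symm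
  rw [hinv]
  set X := proj V ⊥ FQ
  set Y := proj V ⊥ (L * FQ) with hY
  let σ := MvPowerSeries.expand (σ := ι) (R := ℚ) p hp.out.ne_zero
  -- Two evaluations of the degree zero part of `L(x ^ p) F(x)`.
  have h1 : proj V ⊥ (σ L * FQ) = p * Y + p * proj V ⊥ (u * FQ) := by
    change proj V ⊥ (MvPowerSeries.expand p hp.out.ne_zero L * FQ) = _
    rw [hlog, add_mul, map_add, mul_assoc, mul_assoc, proj_natCast_mul, proj_natCast_mul]
  have h2 : proj V ⊥ (σ L * FQ) = lQ * σ Y + p * z := by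
    have h3 : σ L * FQ = σ (L * FQ) * lQ + σ L * (FQ - lQ * σ FQ) := by
      rw [map_mul]
      ring
    have h4 : proj V ⊥ (σ (L * FQ)) = σ Y := proj_bot_expand hp.out.ne_zero hMp _
    rw [h3, map_add, proj_mul hlQ, h4, mul_comm, ← hzE]
  have hσy : σ yQ = lQ * yQ := by
    have h3 : σ yQ * σ X = 1 := by rw [← map_mul, hyQ, map_one]
    calc σ yQ = σ yQ * (yQ * X) := by rw [hyQ, mul_one]
      _ = σ yQ * (yQ * (lQ * σ X)) := by rw [← hlXQ]
      _ = (σ yQ * σ X) * (lQ * yQ) := by ring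
      _ = lQ * yQ := by rw [h3, one_mul]
  refine exp_subst_mem_pSeries (u := (proj V ⊥ (u * FQ) - z) * yQ) ?_
    (mul_mem (sub_mem (proj_mem_pSeries (mul_mem hu hFint)) hz) hyint) ?_
  · rw [map_mul, hY, constantCoeff_proj, map_mul, hL, constantCoeff_logSeries, zero_mul, zero_mul]
  · change σ (Y * yQ) = _
    have h5 : lQ * σ Y = p * Y + p * proj V ⊥ (u * FQ) - p * z := by
      rw [← h1, h2]
      ring
    calc σ (Y * yQ) = lQ * σ Y * yQ := by
          rw [map_mul, hσy]
          ring
      _ = _ := by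
          rw [h5]
          ring

theorem suppOn_exp_subst {L : AddSubgroup M} {x : MvPowerSeries ι ℚ}
    (hx : SuppOn x (fun m => V m ∈ L)) (hx0 : PowerSeries.HasSubst x) :
    SuppOn ((PowerSeries.exp ℚ).subst x) (fun m => V m ∈ L) := by
  have hpow (n : ℕ) : SuppOn (x ^ n) (fun m => V m ∈ L) := by
    induction n with
    | zero => exact suppOn_one (by rw [map_zero]; exact zero_mem _)
    | succ n ih =>
      rw [pow_succ]
      exact ih.mul hx fun a b ha hb => by
        rw [map_add]
        exact add_mem ha hb
  intro m hm
  by_contra h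
  refine hm ?_
  rw [PowerSeries.coeff_subst hx0]
  refine finsum_eq_zero_of_forall_eq_zero fun n => ?_
  rw [not_not.mp fun h0 => h (hpow n m h0), smul_zero]

variable {d p : ℕ} {q : Fin p → ℕ}

theorem map_combSeries : MvPowerSeries.map (Int.castRingHom ℚ) (combSeries ℤ q) =
    combSeries ℚ q := by
  ext m
  rw [MvPowerSeries.coeff_map, coeff_combSeries, coeff_combSeries, map_natCast]

theorem φ₀_eq_proj (v : Idx q → Fin d → ℤ) :
    φ₀ v = proj (degHom v) ⊥ (combSeries ℚ q) := by
  classical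
  ext m
  rw [coeff_proj]
  change (if expo m ∈ K₀ v then (combProd m : ℚ) else 0) = _
  by_cases h : degHom v m ∈ (⊥ : AddSubgroup (Fin d → ℤ))
  · rw [if_pos h, if_pos (expo_mem_K₀_iff.mpr h), coeff_combSeries]
  · rw [if_neg h, if_neg fun h' => h (expo_mem_K₀_iff.mp h')]

theorem φ_eq_proj (v : Idx q → Fin d → ℤ) (a : Idx q) :
    φ v a = proj (degHom v) ⊥ (logSeries (otherVars a) * combSeries ℚ q) := by
  classical
  ext m
  rw [← harmonicSeries_eq, coeff_proj]
  change (if expo m ∈ K₀ v then (combProd m : ℚ) *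
    (harmonic (∑ j, m ⟨a.1, j⟩) - harmonic (m a)) else 0) = _
  by_cases h : degHom v m ∈ (⊥ : AddSubgroup (Fin d → ℤ))
  · rw [if_pos h, if_pos (expo_mem_K₀_iff.mpr h), coeff_harmonicSeries]
    rfl
  · rw [if_neg h, if_neg fun h' => h (expo_mem_K₀_iff.mp h')]

theorem ψ_mem_pSeries {v : Idx q → Fin d → ℤ} (hv : IsFano v) (a : Idx q) (ℓ : ℕ)
    [Fact ℓ.Prime] : ψ v a ∈ pSeries (Idx q) ℓ := by
  rw [ψ, logψ, φ_eq_proj, φ₀_eq_proj, ← map_combSeries]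
  exact exp_quotient_mem_pSeries ℓ (isFanoGauge_gauge hv) (suppOn_blockPoly v)
    blockPoly_mul_combSeries constantCoeff_combSeries _

theorem suppOn_ψ (v : Idx q → Fin d → ℤ) (a : Idx q) :
    SuppOn (ψ v a) (fun m => degHom v m ∈ (⊥ : AddSubgroup (Fin d → ℤ))) := by
  have h0 : SuppOn (φ₀ v) (fun m => degHom v m ∈ (⊥ : AddSubgroup (Fin d → ℤ))) := by
    rw [φ₀_eq_proj]
    exact suppOn_proj _
  have h1 : SuppOn (φ v a) (fun m => degHom v m ∈ (⊥ : AddSubgroup (Fin d → ℤ))) := by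
    rw [φ_eq_proj]
    exact suppOn_proj _
  have hinv : (φ₀ v)⁻¹ * φ₀ v = 1 :=
    MvPowerSeries.inv_mul_cancel _ (by rw [constantCoeff_φ₀]; exact one_ne_zero)
  refine suppOn_exp_subst (h1.mul (suppOn_bot_of_mul_eq_one h0 hinv) fun a b ha hb => ?_)
    (hasSubst_logψ v a)
  rw [map_add]
  exact add_mem ha hb

end Integrality

end NaiveMirror

end

theorem mainTheorem1 {d p : ℕ} {q : Fin p → ℕ} (v : NaiveMirror.Idx q → Fin d → ℤ)
    (hspan : Submodule.span ℤ (Set.range v) = ⊤)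
    (hFano : NaiveMirror.IsFano v)
    (r : ℕ) (hK₀ : Nonempty (NaiveMirror.K₀ v ≃+ (Fin r → ℕ)))
    (a : NaiveMirror.Idx q) :
    NaiveMirror.ψ v a ∈ (NaiveMirror.CompletedRing ℤ v).map
      (MvPowerSeries.map (Int.castRingHom ℚ)) := by
  have hint (m : NaiveMirror.Idx q →₀ ℕ) :
      ∃ n : ℤ, (n : ℚ) = MvPowerSeries.coeff m (NaiveMirror.ψ v a) :=
    NaiveMirror.exists_intCast_eq_of_forall_mem_pInt fun ℓ _ =>
      NaiveMirror.mem_pSeries.mp (NaiveMirror.ψ_mem_pSeries hFano a ℓ) m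
  choose g hg using hint
  let G : MvPowerSeries (NaiveMirror.Idx q) ℤ := g
  refine Subring.mem_map.mpr ⟨G, fun m hm => ?_, ?_⟩
  · refine NaiveMirror.expo_mem_K₀_iff.mpr (NaiveMirror.suppOn_ψ v a m ?_)
    rw [← hg m]
    exact Int.cast_ne_zero.mpr hm
  · ext m
    rw [MvPowerSeries.coeff_map, ← hg m]
    rfl
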